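/- Let $A>0$ and let $\theta,\omega\in(0,\pi)$ satisfy $\cos\frac{\omega}{2}=\sin^2\frac{\theta}{2}\big/\sqrt{\sin^4\frac{\theta}{2}+\cos^4\frac{\theta}{2}}$. For $L\ge 2$ let $c_1,\dots,c_L$ be the fermionic annihilation operators on $(\mathbb C^2)^{\otimes L}$ given by the Jordan–Wigner transformation, $c_j=Z_1\cdots Z_{j-1}\,(|0\rangle\langle 1|)_j$ with $Z=|0\rangle\langle0|-|1\rangle\langle1|$, let $n_j=c_j^\dagger c_j$, and for $s\in\mathbb R$ let $H'(s)=\sum_{i=1}^{L-1}h'(s)_{i,i+1}$ with $$h'(s)_{i,i+1}=-2A\big[(c_i^\dagger c_{i+1}+c_{i+1}^\dagger c_i)+(1+2s)\sin\omega\,(c_ic_{i+1}+c_{i+1}^\dagger c_i^\dagger)+(1+2s)\cos\omega\,(n_i+n_{i+1}-1)-s(2n_i-1)(2n_{i+1}-1)\big].$$ Consider also the open fermion chains $$F(t,\Delta,\mu,U)=\sum_{j=1}^{L-1}\big[-t(c_j^\dagger c_{j+1}+c_{j+1}^\dagger c_j)+\Delta(c_jc_{j+1}+c_{j+1}^\dagger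 c_j^\dagger)\big]-\tfrac12\sum_{j=1}^L\mu_j(2n_j-1)+U\sum_{j=1}^{L-1}(2n_j-1)(2n_{j+1}-1),$$ where $\mu_j=\mu$ in the bulk and $\mu_1=\mu_L=\mu/2$; $F(t,\Delta,\mu,0)$ is the Kitaev chain. A Hamiltonian is called non-interacting if it is a linear combination of products of two of the Majorana operators $a_j=c_j+c_j^\dagger$, $b_j=-i(c_j-c_j^\dagger)$ (constants are included, as $a_j^2=1$). The gap of a Hamiltonian is the distance between its two smallest distinct eigenvalues. Then: 1. For every $B>0$ and $s=(B-A)/2A$, one has $H'(s)=F(2A,\,-2B\sin\omega,\,4B\cos\omega,\,B-A)$ for all $L\ge2$. 2. For every $s>-\frac12$ and every $L\ge 2$, $H'(s)$ is Hermitian and its ground space (the eigenspace of its smallest eigenvalue) is the two-dimensional space $$G_L=\mathrm{span}\Big\{\big(\cos\tfrac\theta2|0\rangle+i\sin\tfrac\theta2|1\rangle\big)^{\otimes L},\ \big(\cos\tfrac\theta2|0\rangle-i\sin\tfrac\theta2|1\rangle\big)^{\otimes L}\Big\},$$ which does not depend on $s$. 3. For every $s>-\frac12$ there is $\delta>0$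 (independent of $L$) such that for every $L\ge2$ the gap of $H'(s)$ is at least $\delta$. 4. $H'(0)=F(2A,-2A\sin\omega,4A\cos\omega,0)$ is a Kitaev chain, and its parameters $t=2A$, $\Delta=-2A\sin\omega$, $\mu=4A\cos\omega$ lie in the topologically ordered regime: $|\mu|<2|t|$ and $\Delta\ne0$. For $s>-\frac12$ and $L\ge2$, $H'(s)$ is non-interacting if and only if $s=0$. 5. The interacting Hamiltonians connect to $H'(0)$ without closing the gap: for each $L\ge2$ the map $s\mapsto H'(s)$ is continuous, and for every $s>-\frac12$ there is $\delta>0$ such that for all $s'$ between $0$ and $s$ and all $L\ge2$ the gap of $H'(s')$ is at least $\delta$. -/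

import Mathlib

open scoped Matrix

noncomputable section

namespace KitaevFF

/-- Index set of the computational basis of a chain with `n` bonds, that is, `L = n + 1` sites:
`x k = 0` (resp. `1`) means that site `k` is in the state `|0⟩` (resp. `|1⟩`). -/
abbrev Config (n : ℕ) : Type := Fin (n + 1) → Fin 2

/-- State vectors of the chain, `(ℂ²)^{⊗(n+1)}`, in coordinates. -/
abbrev State (n : ℕ) : Type := Config n → ℂ

/-- Operators on the chain, as matrices in the computational basis. -/
abbrev Op (n : ℕ) : Type := Matrix (Config n) (Config n) ℂ

/-- The product vector `v ⊗ v ⊗ ⋯ ⊗ v`. -/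
def productState (n : ℕ) (v : Fin 2 → ℂ) : State n := fun x => ∏ k, v (x k)

/-- The operator `M 0 ⊗ M 1 ⊗ ⋯ ⊗ M n`. -/
def tensorOp {n : ℕ} (M : Fin (n + 1) → Matrix (Fin 2) (Fin 2) ℂ) : Op n :=
  Matrix.of fun x y => ∏ k, M k (x k) (y k)

/-- The Pauli matrix `Z = |0⟩⟨0| - |1⟩⟨1|`. -/
def pauliZ : Matrix (Fin 2) (Fin 2) ℂ := !![1, 0; 0, -1]

/-- The matrix `|0⟩⟨1|`. -/
def lowering : Matrix (Fin 2) (Fin 2) ℂ := !![0, 1; 0, 0]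

/-- The fermionic annihilation operator at site `j`, realised on qubits by the Jordan-Wigner
transformation: `c j = Z ⊗ ⋯ ⊗ Z ⊗ |0⟩⟨1| ⊗ 1 ⊗ ⋯ ⊗ 1`, with `|0⟩⟨1|` on site `j`. -/
def c {n : ℕ} (j : Fin (n + 1)) : Op n :=
  tensorOp fun k => if k < j then pauliZ else if k = j then lowering else 1

/-- The number operator `c† c` at site `j`. -/
def num {n : ℕ} (j : Fin (n + 1)) : Op n := (c j)ᴴ * c j

/-- The Majorana operator `a = c + c†` at site `j`. -/
def majoranaA {n : ℕ} (j : Fin (n + 1)) : Op n := c j + (c j)ᴴ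

/-- The Majorana operator `b = -i (c - c†)` at site `j`. -/
def majoranaB {n : ℕ} (j : Fin (n + 1)) : Op n := (-Complex.I) • (c j - (c j)ᴴ)

/-- Operators quadratic in the Majorana operators. Since `a² = 1`, the constants are included. -/
def quadraticOps (n : ℕ) : Submodule ℂ (Op n) :=
  Submodule.span ℂ {T | ∃ γ ∈ Set.range (majoranaA (n := n)) ∪ Set.range (majoranaB (n := n)),
    ∃ γ' ∈ Set.range (majoranaA (n := n)) ∪ Set.range (majoranaB (n := n)), T = γ * γ'}

/-- A fermionic Hamiltonian is non-interacting if it is quadratic in the Majorana operators. -/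
def NonInteracting {n : ℕ} (H : Op n) : Prop := H ∈ quadraticOps n

/-- The open chain of spinless fermions with hopping `t`, pairing `Δ`, on-site chemical potentials
`μ j` and nearest-neighbour interaction `U`. -/
def fermionChain (n : ℕ) (t Δ : ℝ) (μ : Fin (n + 1) → ℝ) (U : ℝ) : Op n :=
  (∑ i : Fin n,
    ((-t) • ((c i.castSucc)ᴴ * c i.succ + (c i.succ)ᴴ * c i.castSucc)
      + Δ • (c i.castSucc * c i.succ + (c i.succ)ᴴ * (c i.castSucc)ᴴ)))
    - (1 / 2 : ℝ) • ∑ j : Fin (n + 1), μ j • ((2 : ℝ) • num j - 1)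
    + U • ∑ i : Fin n, ((2 : ℝ) • num i.castSucc - 1) * ((2 : ℝ) • num i.succ - 1)

/-- Chemical potentials with bulk value `μ` and with half that value at the two ends. -/
def halvedAtEnds (n : ℕ) (μ : ℝ) : Fin (n + 1) → ℝ :=
  fun j => if j = 0 ∨ j = Fin.last n then μ / 2 else μ

/-- The Kitaev chain (no interaction term) with bulk chemical potential `μ`, halved at the
two ends. -/
def kitaevChain (n : ℕ) (t Δ μ : ℝ) : Op n := fermionChain n t Δ (halvedAtEnds n μ) 0

/-- Kitaev's conditions for the topologically ordered regime. -/
def TopologicalRegime (t Δ μ : ℝ) : Prop := |μ| < 2 * |t| ∧ Δ ≠ 0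

/-- The dimer term `h'(s)` acting on sites `i`, `j`. -/
def dimer {n : ℕ} (A ω s : ℝ) (i j : Fin (n + 1)) : Op n :=
  (-2 * A) •
    (((c i)ᴴ * c j + (c j)ᴴ * c i)
      + ((1 + 2 * s) * Real.sin ω) • (c i * c j + (c j)ᴴ * (c i)ᴴ)
      + ((1 + 2 * s) * Real.cos ω) • (num i + num j - 1)
      - s • (((2 : ℝ) • num i - 1) * ((2 : ℝ) • num j - 1)))

/-- The Hamiltonian `H'(s)` on the open chain with `n` bonds (`n + 1` sites). -/
def Hs (A ω s : ℝ) (n : ℕ) : Op n := ∑ i : Fin n, dimer A ω s i.castSucc i.succ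

/-- The real eigenvalues of an operator (all of its eigenvalues, if it is Hermitian). -/
def energies {n : ℕ} (H : Op n) : Set ℝ :=
  {E | Module.End.HasEigenvalue (Matrix.toLin' H) (E : ℂ)}

/-- The smallest energy. -/
def groundEnergy {n : ℕ} (H : Op n) : ℝ := sInf (energies H)

/-- The eigenspace of the smallest energy. -/
def groundSpace {n : ℕ} (H : Op n) : Submodule ℂ (State n) :=
  Module.End.eigenspace (Matrix.toLin' H) (groundEnergy H : ℂ)

/-- The spectral gap above the ground energy is at least `δ`. -/
def GapAtLeast {n : ℕ} (H : Op n) (δ : ℝ) : Prop :=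
  ∀ E ∈ energies H, E ≠ groundEnergy H → groundEnergy H + δ ≤ E

/-- The single-qubit state `cos (θ/2) |0⟩ + i sin (θ/2) |1⟩`. -/
def ketAlpha (θ : ℝ) : Fin 2 → ℂ :=
  ![(Real.cos (θ / 2) : ℂ), Complex.I * (Real.sin (θ / 2) : ℂ)]

/-- The single-qubit state `cos (θ/2) |0⟩ - i sin (θ/2) |1⟩`. -/
def ketBeta (θ : ℝ) : Fin 2 → ℂ :=
  ![(Real.cos (θ / 2) : ℂ), -(Complex.I * (Real.sin (θ / 2) : ℂ))]

/-- The span `G_L` of the two product states, `L = n + 1`. -/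
def productSpan (θ : ℝ) (n : ℕ) : Submodule ℂ (State n) :=
  Submodule.span ℂ {productState n (ketAlpha θ), productState n (ketBeta θ)}

end KitaevFF

end

open scoped Matrix

noncomputable section

namespace KitaevFF

/-! Attach to each bond the fermionic mode d = (sin(ω/2)(c_i - c_j) + cos(ω/2)(c_i† + c_j†))/√2
(`bondMode`), and let W be the product of the two local parities (`bondParity`). The whole argument
rests on the factorisation `dimer_eq`: h'(s) = -2A(1+s) + 4A d†((1+s) - sW)d. Hence, on n bonds,
H'(s) = -2A(1+s)n + 4A K_s, where K_s is `parentOp`. As W has eigenvalues ±1, the middle factor is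
at least min(1, 1+2s), so for s > -1/2 each K_s is positive, K_s ≥ min(1, 1+2s) K_0
(`inner_parentOp_ge`), and its kernel is the common kernel of the bond modes, whatever s is.

Ground space: dψ = 0 on a bond says that 01 and 10 have equal amplitudes there and that the
amplitude of 11 is a fixed multiple of that of 00. Moving ones to the left and deleting adjacent
pairs reduces every amplitude to two of them, so the kernel has dimension at most two; the two
product states lie in it and are independent (`mem_productSpan_iff`, `finrank_productSpan`).

Gap: the bond modes anticommute, and {d_i, d_j†} is the scalar δ_ij plus cos ω/2 for adjacent bonds.
Expanding the square of K_0 = Σ d†d gives K_0² ≥ (1 - |cos ω|) K_0 (`norm_sum_adjoint_sq_ge`), a gap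
independent of the length. `eigenvalue_ge_of_gap` carries it over to K_s through the comparison of
the two forms and the common kernel.

Interaction: W is trace-orthogonal to all products of two Majorana operators
(`trace_bondParity_mul_of_mem_quadraticOps`), and the non-quadratic part of H'(s) is 2As ΣW, which
pairs nontrivially with the W of the first bond unless s = 0. The halved end potentials are what
makes the site sum of the fermion chain a sum over bonds (`sum_halvedAtEnds_smul`). -/

/-! ### Tensor products of single-site matrices -/

lemma tensorOp_apply {n : ℕ} (M : Fin (n + 1) → Matrix (Fin 2) (Fin 2) ℂ) (x y : Config n) :
    tensorOp M x y = ∏ k, M k (x k) (y k) := rfl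

lemma tensorOp_mul {n : ℕ} (M N : Fin (n + 1) → Matrix (Fin 2) (Fin 2) ℂ) :
    tensorOp M * tensorOp N = tensorOp fun k => M k * N k := by
  ext x y
  simp only [Matrix.mul_apply, tensorOp_apply, ← Finset.prod_mul_distrib]
  rw [Finset.prod_univ_sum]
  simp [Fintype.piFinset_univ]

lemma tensorOp_conjTranspose {n : ℕ} (M : Fin (n + 1) → Matrix (Fin 2) (Fin 2) ℂ) :
    (tensorOp M)ᴴ = tensorOp fun k => (M k)ᴴ := by
  ext x y
  simp [tensorOp_apply, Matrix.conjTranspose_apply]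

lemma trace_tensorOp {n : ℕ} (M : Fin (n + 1) → Matrix (Fin 2) (Fin 2) ℂ) :
    (tensorOp M).trace = ∏ k, (M k).trace := by
  simp only [Matrix.trace, Matrix.diag_apply, tensorOp_apply]
  rw [Finset.prod_univ_sum, Fintype.piFinset_univ]

lemma tensorOp_one {n : ℕ} : (tensorOp fun _ => 1 : Op n) = 1 := by
  ext x y
  rw [tensorOp_apply]
  by_cases h : x = y
  · subst h
    rw [Matrix.one_apply_eq]
    exact Finset.prod_eq_one fun k _ => Matrix.one_apply_eq _
  · obtain ⟨k, hk⟩ := Function.ne_iff.mp h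
    rw [Matrix.one_apply_ne h]
    exact Finset.prod_eq_zero (Finset.mem_univ k) (Matrix.one_apply_ne hk)

lemma tensorOp_update_apply {n : ℕ} (M : Fin (n + 1) → Matrix (Fin 2) (Fin 2) ℂ)
    (i : Fin (n + 1)) (R : Matrix (Fin 2) (Fin 2) ℂ) (x y : Config n) :
    tensorOp (Function.update M i R) x y =
      R (x i) (y i) * ∏ k ∈ Finset.univ.erase i, M k (x k) (y k) := by
  rw [tensorOp_apply, ← Finset.mul_prod_erase _ _ (Finset.mem_univ i)]
  congr 1
  · simp
  · refine Finset.prod_congr rfl fun k hk => ?_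
    rw [Function.update_of_ne (Finset.ne_of_mem_erase hk)]

lemma tensorOp_update_add {n : ℕ} (M : Fin (n + 1) → Matrix (Fin 2) (Fin 2) ℂ)
    (i : Fin (n + 1)) (P Q : Matrix (Fin 2) (Fin 2) ℂ) :
    tensorOp (Function.update M i (P + Q)) =
      tensorOp (Function.update M i P) + tensorOp (Function.update M i Q) := by
  ext x y
  simp only [Matrix.add_apply, tensorOp_update_apply]
  ring

lemma tensorOp_update_smul {n : ℕ} (M : Fin (n + 1) → Matrix (Fin 2) (Fin 2) ℂ)
    (i : Fin (n + 1)) (a : ℂ) (P : Matrix (Fin 2) (Fin 2) ℂ) :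
    tensorOp (Function.update M i (a • P)) = a • tensorOp (Function.update M i P) := by
  ext x y
  simp only [Matrix.smul_apply, tensorOp_update_apply, smul_eq_mul]
  ring

lemma tensorOp_eq_neg {n : ℕ} {M N : Fin (n + 1) → Matrix (Fin 2) (Fin 2) ℂ}
    (i : Fin (n + 1)) (hi : M i = -N i) (h : ∀ k, k ≠ i → M k = N k) :
    tensorOp M = -tensorOp N := by
  have hM : M = Function.update N i ((-1 : ℂ) • N i) := by
    funext k
    by_cases hk : k = i
    · subst hk; simp [hi]
    · rw [Function.update_of_ne hk, h k hk]
  rw [hM, tensorOp_update_smul, Function.update_eq_self, neg_one_smul]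

/-! ### Jordan-Wigner strings and single-site operators -/

/-- The operator `Z ⊗ ⋯ ⊗ Z ⊗ B ⊗ 1 ⊗ ⋯ ⊗ 1` with `B` on site `j`. -/
def jordanWigner {n : ℕ} (j : Fin (n + 1)) (B : Matrix (Fin 2) (Fin 2) ℂ) : Op n :=
  tensorOp fun k => if k < j then pauliZ else if k = j then B else 1

/-- The operator acting as `B` on site `j` and trivially elsewhere. -/
def siteOp {n : ℕ} (j : Fin (n + 1)) (B : Matrix (Fin 2) (Fin 2) ℂ) : Op n :=
  tensorOp (Function.update (fun _ => 1) j B)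

lemma jordanWigner_eq_update {n : ℕ} (j : Fin (n + 1)) (B : Matrix (Fin 2) (Fin 2) ℂ) :
    jordanWigner j B =
      tensorOp (Function.update (fun k => if k < j then pauliZ else 1) j B) := by
  unfold jordanWigner
  congr 1
  funext k
  by_cases hk : k = j
  · subst hk; simp
  · simp [hk]

lemma jordanWigner_add {n : ℕ} (j : Fin (n + 1)) (B D : Matrix (Fin 2) (Fin 2) ℂ) :
    jordanWigner j (B + D) = jordanWigner j B + jordanWigner j D := by
  simp only [jordanWigner_eq_update, tensorOp_update_add]

lemma jordanWigner_smul {n : ℕ} (j : Fin (n + 1)) (a : ℂ) (B : Matrix (Fin 2) (Fin 2) ℂ) :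
    jordanWigner j (a • B) = a • jordanWigner j B := by
  simp only [jordanWigner_eq_update, tensorOp_update_smul]

lemma pauliZ_mul_pauliZ : pauliZ * pauliZ = 1 := by
  simp [pauliZ, Matrix.one_fin_two]

lemma pauliZ_conjTranspose : pauliZᴴ = pauliZ := by
  ext a b; fin_cases a <;> fin_cases b <;> simp [pauliZ]

lemma jordanWigner_conjTranspose {n : ℕ} (j : Fin (n + 1)) (B : Matrix (Fin 2) (Fin 2) ℂ) :
    (jordanWigner j B)ᴴ = jordanWigner j Bᴴ := by
  unfold jordanWigner
  rw [tensorOp_conjTranspose]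
  congr 1
  funext k
  split_ifs <;> simp [pauliZ_conjTranspose]

lemma jordanWigner_mul_self_site {n : ℕ} (j : Fin (n + 1)) (B D : Matrix (Fin 2) (Fin 2) ℂ) :
    jordanWigner j B * jordanWigner j D = siteOp j (B * D) := by
  unfold jordanWigner siteOp
  rw [tensorOp_mul]
  congr 1
  funext k
  by_cases hk : k = j
  · subst hk; simp
  · rw [Function.update_of_ne hk]
    split_ifs <;> simp [pauliZ_mul_pauliZ]

lemma siteOp_add {n : ℕ} (j : Fin (n + 1)) (B D : Matrix (Fin 2) (Fin 2) ℂ) :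
    (siteOp j (B + D) : Op n) = siteOp j B + siteOp j D := by
  simp only [siteOp, tensorOp_update_add]

lemma siteOp_smul {n : ℕ} (j : Fin (n + 1)) (a : ℂ) (B : Matrix (Fin 2) (Fin 2) ℂ) :
    (siteOp j (a • B) : Op n) = a • siteOp j B := by
  simp only [siteOp, tensorOp_update_smul]

lemma siteOp_zero {n : ℕ} (j : Fin (n + 1)) : (siteOp j 0 : Op n) = 0 := by
  simpa using siteOp_smul (n := n) j 0 0

lemma siteOp_one {n : ℕ} (j : Fin (n + 1)) : (siteOp j 1 : Op n) = 1 := by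
  rw [siteOp, Function.update_eq_self j (fun _ => 1), tensorOp_one]

/-- The two products differ only on site `i`, where `B` meets the string of `j`; this is why nothing
is asked of `D`. -/
lemma jordanWigner_anticomm_of_lt {n : ℕ} {i j : Fin (n + 1)} (hij : i < j)
    {B D : Matrix (Fin 2) (Fin 2) ℂ} (hB : B * pauliZ = -(pauliZ * B)) :
    jordanWigner i B * jordanWigner j D = -(jordanWigner j D * jordanWigner i B) := by
  unfold jordanWigner
  rw [tensorOp_mul, tensorOp_mul]
  refine tensorOp_eq_neg i (by simp [hij, hB]) fun k hk => ?_
  rcases lt_or_gt_of_ne hk with h | h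
  · simp [h, h.trans hij]
  · simp [h.not_gt, hk]

lemma jordanWigner_anticomm {n : ℕ} {i j : Fin (n + 1)} (hij : i ≠ j)
    {B D : Matrix (Fin 2) (Fin 2) ℂ} (hB : B * pauliZ = -(pauliZ * B))
    (hD : D * pauliZ = -(pauliZ * D)) :
    jordanWigner i B * jordanWigner j D = -(jordanWigner j D * jordanWigner i B) := by
  rcases lt_or_gt_of_ne hij with h | h
  · exact jordanWigner_anticomm_of_lt h hB
  · rw [jordanWigner_anticomm_of_lt h hD, neg_neg]

/-! ### Canonical anticommutation relations -/

lemma c_eq_jordanWigner {n : ℕ} (j : Fin (n + 1)) : c j = jordanWigner j lowering := rfl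

lemma c_conjTranspose {n : ℕ} (j : Fin (n + 1)) : (c j)ᴴ = jordanWigner j loweringᴴ :=
  jordanWigner_conjTranspose j lowering

lemma lowering_mul_pauliZ : lowering * pauliZ = -(pauliZ * lowering) := by
  ext a b; fin_cases a <;> fin_cases b <;> simp [pauliZ, lowering]

lemma lowering_conjTranspose : loweringᴴ = !![0, 0; 1, 0] := by
  ext a b; fin_cases a <;> fin_cases b <;> simp [lowering]

lemma raising_mul_pauliZ : loweringᴴ * pauliZ = -(pauliZ * loweringᴴ) := by
  rw [lowering_conjTranspose]
  ext a b
  fin_cases a <;> fin_cases b <;> simp [pauliZ]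

lemma lowering_mul_lowering : lowering * lowering = 0 := by
  ext a b; fin_cases a <;> fin_cases b <;> simp [lowering]

lemma lowering_anticomm : lowering * loweringᴴ + loweringᴴ * lowering = 1 := by
  rw [lowering_conjTranspose]
  ext a b
  fin_cases a <;> fin_cases b <;> simp [lowering]

lemma c_anticomm {n : ℕ} (i j : Fin (n + 1)) : c i * c j + c j * c i = 0 := by
  by_cases h : i = j
  · subst h
    rw [c_eq_jordanWigner, jordanWigner_mul_self_site, lowering_mul_lowering, siteOp_zero,
      add_zero]
  · rw [c_eq_jordanWigner, c_eq_jordanWigner,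
      jordanWigner_anticomm h lowering_mul_pauliZ lowering_mul_pauliZ, neg_add_cancel]

lemma c_conjTranspose_anticomm {n : ℕ} (i j : Fin (n + 1)) :
    (c i)ᴴ * (c j)ᴴ + (c j)ᴴ * (c i)ᴴ = 0 := by
  simpa using congrArg Matrix.conjTranspose (c_anticomm j i)

lemma c_mul_conjTranspose_anticomm {n : ℕ} (i j : Fin (n + 1)) :
    c i * (c j)ᴴ + (c j)ᴴ * c i = if i = j then 1 else 0 := by
  by_cases h : i = j
  · subst h
    rw [c_conjTranspose, c_eq_jordanWigner, jordanWigner_mul_self_site,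
      jordanWigner_mul_self_site, ← siteOp_add, lowering_anticomm, siteOp_one, if_pos rfl]
  · rw [c_conjTranspose, c_eq_jordanWigner,
      jordanWigner_anticomm h lowering_mul_pauliZ raising_mul_pauliZ, neg_add_cancel, if_neg h]

/-! ### Action on amplitudes -/

/-- The sign of the Jordan-Wigner string to the left of site `j`. -/
def stringSign {n : ℕ} (j : Fin (n + 1)) (x : Config n) : ℂ :=
  ∏ k, if k < j then pauliZ (x k) (x k) else 1

lemma jordanWigner_apply_update {n : ℕ} (j : Fin (n + 1)) (B : Matrix (Fin 2) (Fin 2) ℂ)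
    (x : Config n) (b : Fin 2) :
    jordanWigner j B x (Function.update x j b) = stringSign j x * B (x j) b := by
  have : stringSign j x * B (x j) b =
      ∏ k, (if k < j then pauliZ (x k) (x k) else 1) * (if k = j then B (x j) b else 1) := by
    rw [Finset.prod_mul_distrib, Finset.prod_ite_eq']
    simp [stringSign]
  rw [this, jordanWigner, tensorOp_apply]
  refine Finset.prod_congr rfl fun k _ => ?_
  by_cases hk : k = j
  · subst hk; simp
  · rw [Function.update_of_ne hk]
    split_ifs <;> simp

lemma jordanWigner_apply_eq_zero {n : ℕ} (j : Fin (n + 1)) (B : Matrix (Fin 2) (Fin 2) ℂ)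
    {x y : Config n} (h : ∀ b, y ≠ Function.update x j b) : jordanWigner j B x y = 0 := by
  obtain ⟨k, hk⟩ := Function.ne_iff.mp (h (y j))
  have hkj : k ≠ j := by rintro rfl; simp at hk
  rw [Function.update_of_ne hkj] at hk
  rw [jordanWigner, tensorOp_apply]
  refine Finset.prod_eq_zero (Finset.mem_univ k) ?_
  rw [if_neg hkj]
  split_ifs
  · generalize y k = a at hk
    generalize x k = b at hk
    fin_cases a <;> fin_cases b <;> simp_all [pauliZ]
  · exact Matrix.one_apply_ne (Ne.symm hk)

lemma jordanWigner_mulVec {n : ℕ} (j : Fin (n + 1)) (B : Matrix (Fin 2) (Fin 2) ℂ)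
    (ψ : State n) (x : Config n) :
    (jordanWigner j B *ᵥ ψ) x =
      stringSign j x * ∑ b, B (x j) b * ψ (Function.update x j b) := by
  have hinj : Function.Injective fun b => Function.update x j b :=
    Function.update_injective x j
  rw [Matrix.mulVec, dotProduct, Finset.mul_sum,
    ← Finset.sum_subset (Finset.subset_univ (Finset.univ.image fun b => Function.update x j b)),
    Finset.sum_image hinj.injOn]
  · refine Finset.sum_congr rfl fun b _ => ?_
    rw [jordanWigner_apply_update, mul_assoc]
  · intro y _ hy
    rw [jordanWigner_apply_eq_zero, zero_mul]
    rintro b rfl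
    exact hy (Finset.mem_image_of_mem _ (Finset.mem_univ b))

lemma c_mulVec {n : ℕ} (j : Fin (n + 1)) (ψ : State n) (x : Config n) :
    (c j *ᵥ ψ) x =
      stringSign j x * (if x j = 0 then ψ (Function.update x j 1) else 0) := by
  rw [c_eq_jordanWigner, jordanWigner_mulVec]
  generalize x j = a
  fin_cases a <;> simp [lowering]

lemma c_conjTranspose_mulVec {n : ℕ} (j : Fin (n + 1)) (ψ : State n) (x : Config n) :
    ((c j)ᴴ *ᵥ ψ) x =
      stringSign j x * (if x j = 0 then 0 else ψ (Function.update x j 0)) := by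
  rw [c_conjTranspose, jordanWigner_mulVec]
  generalize x j = a
  fin_cases a <;> simp [lowering]

/-! ### Bond modes and the factorisation of the dimer term -/

/-- The bond mode `(sin (ω/2) (c i - c j) + cos (ω/2) (c† i + c† j)) / √2`. -/
def bondMode {n : ℕ} (ω : ℝ) (i j : Fin (n + 1)) : Op n :=
  ((1 / Real.sqrt 2 : ℝ) : ℂ) • ((Real.sin (ω / 2) : ℂ) • (c i - c j) +
    (Real.cos (ω / 2) : ℂ) • ((c i)ᴴ + (c j)ᴴ))

/-- The product of the local parities `2 n - 1` at sites `i` and `j`. -/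
def bondParity {n : ℕ} (i j : Fin (n + 1)) : Op n :=
  ((2 : ℝ) • num i - 1) * ((2 : ℝ) • num j - 1)

/-- The configuration `x` with the values at `i` and `j` replaced by `a` and `b`. -/
def setPair {n : ℕ} (i j : Fin (n + 1)) (x : Config n) (a b : Fin 2) : Config n :=
  Function.update (Function.update x i a) j b

lemma setPair_self {n : ℕ} (i j : Fin (n + 1)) (x : Config n) :
    setPair i j x (x i) (x j) = x := by
  simp [setPair]

lemma stringSign_update_of_le {n : ℕ} {j k : Fin (n + 1)} (h : j ≤ k) (x : Config n)
    (a : Fin 2) : stringSign j (Function.update x k a) = stringSign j x := by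
  refine Finset.prod_congr rfl fun l _ => ?_
  split_ifs with hl
  · rw [Function.update_of_ne (hl.trans_le h).ne]
  · rfl

lemma stringSign_mul_self {n : ℕ} (j : Fin (n + 1)) (x : Config n) :
    stringSign j x * stringSign j x = 1 := by
  rw [stringSign, ← Finset.prod_mul_distrib]
  refine Finset.prod_eq_one fun k _ => ?_
  generalize x k = a
  fin_cases a <;> split_ifs <;> simp [pauliZ]

lemma stringSign_succ {n : ℕ} (i : Fin n) (x : Config n) :
    stringSign i.succ x = stringSign i.castSucc x * pauliZ (x i.castSucc) (x i.castSucc) := by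
  have : pauliZ (x i.castSucc) (x i.castSucc) =
      ∏ k, if k = i.castSucc then pauliZ (x k) (x k) else 1 := by
    rw [Finset.prod_ite_eq']; simp
  rw [this, stringSign, stringSign, ← Finset.prod_mul_distrib]
  refine Finset.prod_congr rfl fun k _ => ?_
  rcases lt_trichotomy k i.castSucc with h | h | h
  · simp [h, h.ne, h.trans (Fin.castSucc_lt_succ (i := i))]
  · simp [h]
  · have : ¬ k < i.succ := by
      simp only [Fin.lt_def, Fin.val_castSucc, Fin.val_succ] at *; omega
    simp [this, h.ne', h.not_gt]

section Pair

variable {n : ℕ} (i : Fin n) (ψ : State n) (x : Config n) (a b : Fin 2)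

lemma stringSign_castSucc_setPair :
    stringSign i.castSucc (setPair i.castSucc i.succ x a b) = stringSign i.castSucc x := by
  rw [setPair, stringSign_update_of_le (Fin.castSucc_lt_succ (i := i)).le,
    stringSign_update_of_le le_rfl]

lemma setPair_castSucc : setPair i.castSucc i.succ x a b i.castSucc = a := by
  rw [setPair, Function.update_of_ne (Fin.castSucc_lt_succ (i := i)).ne, Function.update_self]

lemma setPair_succ : setPair i.castSucc i.succ x a b i.succ = b := by
  rw [setPair, Function.update_self]

lemma update_castSucc_setPair (d : Fin 2) :
    Function.update (setPair i.castSucc i.succ x a b) i.castSucc d =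
      setPair i.castSucc i.succ x d b := by
  rw [setPair, setPair, Function.update_comm (Fin.castSucc_lt_succ (i := i)).ne',
    Function.update_idem]

lemma update_succ_setPair (d : Fin 2) :
    Function.update (setPair i.castSucc i.succ x a b) i.succ d =
      setPair i.castSucc i.succ x a d := by
  rw [setPair, setPair, Function.update_idem]

lemma c_castSucc_mulVec_setPair :
    (c i.castSucc *ᵥ ψ) (setPair i.castSucc i.succ x a b) = stringSign i.castSucc x *
      (if a = 0 then ψ (setPair i.castSucc i.succ x 1 b) else 0) := by
  rw [c_mulVec, stringSign_castSucc_setPair, setPair_castSucc, update_castSucc_setPair]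

lemma c_castSucc_conjTranspose_mulVec_setPair :
    ((c i.castSucc)ᴴ *ᵥ ψ) (setPair i.castSucc i.succ x a b) = stringSign i.castSucc x *
      (if a = 0 then 0 else ψ (setPair i.castSucc i.succ x 0 b)) := by
  rw [c_conjTranspose_mulVec, stringSign_castSucc_setPair, setPair_castSucc,
    update_castSucc_setPair]

lemma c_succ_mulVec_setPair :
    (c i.succ *ᵥ ψ) (setPair i.castSucc i.succ x a b) = stringSign i.castSucc x *
      pauliZ a a * (if b = 0 then ψ (setPair i.castSucc i.succ x a 1) else 0) := by
  rw [c_mulVec, stringSign_succ, stringSign_castSucc_setPair, setPair_succ, setPair_castSucc,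
    update_succ_setPair]

lemma c_succ_conjTranspose_mulVec_setPair :
    ((c i.succ)ᴴ *ᵥ ψ) (setPair i.castSucc i.succ x a b) = stringSign i.castSucc x *
      pauliZ a a * (if b = 0 then 0 else ψ (setPair i.castSucc i.succ x a 0)) := by
  rw [c_conjTranspose_mulVec, stringSign_succ, stringSign_castSucc_setPair, setPair_succ,
    setPair_castSucc, update_succ_setPair]

lemma num_castSucc_mulVec_setPair :
    (num i.castSucc *ᵥ ψ) (setPair i.castSucc i.succ x a b) =
      if a = 0 then 0 else ψ (setPair i.castSucc i.succ x a b) := by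
  rw [num, ← Matrix.mulVec_mulVec, c_castSucc_conjTranspose_mulVec_setPair,
    c_castSucc_mulVec_setPair]
  have := stringSign_mul_self i.castSucc x
  fin_cases a
  · simp
  · simp [← mul_assoc, this]

lemma num_succ_mulVec_setPair :
    (num i.succ *ᵥ ψ) (setPair i.castSucc i.succ x a b) =
      if b = 0 then 0 else ψ (setPair i.castSucc i.succ x a b) := by
  rw [num, ← Matrix.mulVec_mulVec, c_succ_conjTranspose_mulVec_setPair, c_succ_mulVec_setPair]
  have := stringSign_mul_self i.castSucc x
  fin_cases b
  · simp
  · fin_cases a <;> simp [← mul_assoc, this, pauliZ]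

lemma bondParity_mulVec_setPair :
    (bondParity i.castSucc i.succ *ᵥ ψ) (setPair i.castSucc i.succ x a b) =
      pauliZ a a * pauliZ b b * ψ (setPair i.castSucc i.succ x a b) := by
  rw [bondParity, ← Matrix.mulVec_mulVec]
  simp only [Matrix.sub_mulVec, Matrix.smul_mulVec, Matrix.one_mulVec, Pi.sub_apply,
    Pi.smul_apply, num_castSucc_mulVec_setPair, num_succ_mulVec_setPair, Complex.real_smul]
  fin_cases a <;> fin_cases b <;> simp [pauliZ] <;> ring

lemma bondMode_mulVec_setPair (ω : ℝ) :
    (bondMode ω i.castSucc i.succ *ᵥ ψ) (setPair i.castSucc i.succ x a b) =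
      ((1 / Real.sqrt 2 : ℝ) : ℂ) * stringSign i.castSucc x *
        (Real.sin (ω / 2) * ((if a = 0 then ψ (setPair i.castSucc i.succ x 1 b) else 0) -
            pauliZ a a * (if b = 0 then ψ (setPair i.castSucc i.succ x a 1) else 0)) +
          Real.cos (ω / 2) * ((if a = 0 then 0 else ψ (setPair i.castSucc i.succ x 0 b)) +
            pauliZ a a * (if b = 0 then 0 else ψ (setPair i.castSucc i.succ x a 0)))) := by
  simp only [bondMode, Matrix.add_mulVec, Matrix.sub_mulVec, Matrix.smul_mulVec, Pi.sub_apply,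
    Pi.add_apply, Pi.smul_apply, c_castSucc_mulVec_setPair, c_succ_mulVec_setPair,
    c_castSucc_conjTranspose_mulVec_setPair, c_succ_conjTranspose_mulVec_setPair, smul_eq_mul]
  ring

lemma bondMode_conjTranspose_mulVec_setPair (ω : ℝ) :
    ((bondMode ω i.castSucc i.succ)ᴴ *ᵥ ψ) (setPair i.castSucc i.succ x a b) =
      ((1 / Real.sqrt 2 : ℝ) : ℂ) * stringSign i.castSucc x *
        (Real.sin (ω / 2) * ((if a = 0 then 0 else ψ (setPair i.castSucc i.succ x 0 b)) -
            pauliZ a a * (if b = 0 then 0 else ψ (setPair i.castSucc i.succ x a 0))) +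
          Real.cos (ω / 2) * ((if a = 0 then ψ (setPair i.castSucc i.succ x 1 b) else 0) +
            pauliZ a a * (if b = 0 then ψ (setPair i.castSucc i.succ x a 1) else 0))) := by
  simp only [bondMode, Matrix.conjTranspose_smul, Matrix.conjTranspose_add,
    Matrix.conjTranspose_sub, Matrix.conjTranspose_conjTranspose, RCLike.star_def,
    Complex.conj_ofReal, Matrix.add_mulVec, Matrix.sub_mulVec, Matrix.smul_mulVec, Pi.sub_apply,
    Pi.add_apply, Pi.smul_apply, c_castSucc_mulVec_setPair, c_succ_mulVec_setPair,
    c_castSucc_conjTranspose_mulVec_setPair, c_succ_conjTranspose_mulVec_setPair, smul_eq_mul]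
  ring

end Pair

lemma inv_sqrt_two_mul_self : ((1 / Real.sqrt 2 : ℝ) : ℂ) * ((1 / Real.sqrt 2 : ℝ) : ℂ) = 1 / 2 := by
  rw [← Complex.ofReal_mul, div_mul_div_comm, Real.mul_self_sqrt (by norm_num)]
  norm_num

lemma cos_half_mul_self (ω : ℝ) : (Real.cos (ω / 2) : ℂ) * Real.cos (ω / 2) =
    1 - Real.sin (ω / 2) * Real.sin (ω / 2) := by
  have := Real.cos_sq_add_sin_sq (ω / 2)
  rw [← Complex.ofReal_mul, ← Complex.ofReal_mul, ← Complex.ofReal_one, ← Complex.ofReal_sub]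
  congr 1; linarith

lemma cos_eq_one_sub (ω : ℝ) :
    (Real.cos ω : ℂ) = 1 - 2 * Real.sin (ω / 2) * Real.sin (ω / 2) := by
  have hcs := cos_half_mul_self ω
  conv_lhs => rw [show ω = 2 * (ω / 2) by ring, Real.cos_two_mul]
  push_cast at hcs ⊢
  linear_combination 2 * hcs

/-- The mode d changes the parity of the bond. From 00, 11 it leads to 01, 10, where W = -1 and the
middle factor is 1 + 2s; from 01, 10 it leads to 00, 11, where W = 1 and the factor is 1. So s
rescales pairing and potential but not hopping. -/
lemma dimer_eq {n : ℕ} (A ω s : ℝ) (i : Fin n) :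
    dimer A ω s i.castSucc i.succ = (-2 * A * (1 + s)) • (1 : Op n) +
      (4 * A) • ((bondMode ω i.castSucc i.succ)ᴴ *
        ((1 + s) • (1 : Op n) - s • bondParity i.castSucc i.succ) *
          bondMode ω i.castSucc i.succ) := by
  -- Only the two sites of the bond and the string to their left matter, so it is enough to compare
  -- the four local amplitudes of both sides on an arbitrary vector.
  refine Matrix.ext_of_mulVec_single fun y => ?_
  generalize (Pi.single y 1 : State n) = ψ
  funext x
  rw [← setPair_self i.castSucc i.succ x]
  generalize x i.castSucc = a
  generalize x i.succ = b
  have hσ := stringSign_mul_self i.castSucc x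
  have h2 := inv_sqrt_two_mul_self
  have hcs := cos_half_mul_self ω
  have hsin : (Real.sin ω : ℂ) = 2 * Real.sin (ω / 2) * Real.cos (ω / 2) := by
    rw [← mul_div_cancel₀ ω (two_ne_zero' ℝ), Real.sin_two_mul]
    simp
  have hcos := cos_eq_one_sub ω
  rw [dimer, ← bondParity]
  simp only [Matrix.add_mulVec, Matrix.sub_mulVec, Matrix.smul_mulVec, Matrix.one_mulVec,
    ← Matrix.mulVec_mulVec, Pi.add_apply, Pi.sub_apply, Pi.smul_apply,
    bondMode_conjTranspose_mulVec_setPair, bondMode_mulVec_setPair, bondParity_mulVec_setPair,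
    num_castSucc_mulVec_setPair, num_succ_mulVec_setPair,
    c_castSucc_mulVec_setPair, c_succ_mulVec_setPair,
    c_castSucc_conjTranspose_mulVec_setPair, c_succ_conjTranspose_mulVec_setPair,
    Complex.real_smul, Complex.ofReal_mul, hsin, hcos]
  generalize stringSign i.castSucc x = σ at *
  generalize ((1 / Real.sqrt 2 : ℝ) : ℂ) = r at *
  generalize (Real.cos (ω / 2) : ℂ) = C at *
  generalize (Real.sin (ω / 2) : ℂ) = S at *
  generalize setPair i.castSucc i.succ x = y at *
  -- Both d and d† carry one factor rσ, so the string sign drops out of their product.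
  have hρ : r * σ * (r * σ) = 1 / 2 := by linear_combination h2 + r * r * hσ
  fin_cases a <;> fin_cases b <;> simp [pauliZ]
  · linear_combination 4 * A * (1 + 2 * s) * S * C * ψ (y 1 1) * hσ -
      8 * A * (1 + 2 * s) * C * (S * ψ (y 1 1) + C * ψ (y 0 0)) * hρ -
      4 * A * (1 + 2 * s) * ψ (y 0 0) * hcs
  · linear_combination -2 * A * ψ (y 1 0) * hσ -
      4 * A * (ψ (y 0 1) - ψ (y 1 0)) * (S * S + C * C) * hρ -
      2 * A * (ψ (y 0 1) - ψ (y 1 0)) * hcs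
  · linear_combination -2 * A * ψ (y 0 1) * hσ -
      4 * A * (ψ (y 1 0) - ψ (y 0 1)) * (S * S + C * C) * hρ -
      2 * A * (ψ (y 1 0) - ψ (y 0 1)) * hcs
  · linear_combination 4 * A * (1 + 2 * s) * S * C * ψ (y 0 0) * hσ -
      8 * A * (1 + 2 * s) * S * (S * ψ (y 1 1) + C * ψ (y 0 0)) * hρ

/-! ### Anticommutators of the bond modes -/

/-- The signs `s`, `s'` let one expansion cover both d (sign 1) and d† (sign -1, with sine and
cosine exchanged). -/
lemma anticommutator_bilinear {R : Type*} [Ring R] [Algebra ℂ R] {r a b a' b' : ℂ}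
    {p q p' q' u v u' v' : R} {α₁ α₂ α₃ α₄ β₁ β₂ β₃ β₄ : ℂ}
    (h1 : p * u + u * p = 0) (h2 : p * v + v * p = 0) (h3 : q * u + u * q = 0)
    (h4 : q * v + v * q = 0) (h5 : p' * u' + u' * p' = 0) (h6 : p' * v' + v' * p' = 0)
    (h7 : q' * u' + u' * q' = 0) (h8 : q' * v' + v' * q' = 0)
    (k1 : p * u' + u' * p = α₁ • 1) (k2 : p * v' + v' * p = α₂ • 1)
    (k3 : q * u' + u' * q = α₃ • 1) (k4 : q * v' + v' * q = α₄ • 1)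
    (k5 : p' * u + u * p' = β₁ • 1) (k6 : p' * v + v * p' = β₂ • 1)
    (k7 : q' * u + u * q' = β₃ • 1) (k8 : q' * v + v * q' = β₄ • 1) (s s' : ℂ) :
    (r • (a • (p - s • q) + b • (p' + s • q'))) * (r • (a' • (u - s' • v) + b' • (u' + s' • v')))
      + (r • (a' • (u - s' • v) + b' • (u' + s' • v'))) *
        (r • (a • (p - s • q) + b • (p' + s • q'))) =
      (r * r * (a * b' * (α₁ + s' * α₂ - s * α₃ - s * s' * α₄) +
        b * a' * (β₁ - s' * β₂ + s * β₃ - s * s' * β₄))) • 1 := by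
  simp only [smul_mul_assoc, mul_smul_comm, mul_add, add_mul, mul_sub, sub_mul, smul_add,
    smul_sub, smul_smul]
  linear_combination (norm := module) (r * r * a * a') • h1 - (r * r * a * a' * s') • h2
    - (r * r * a * a' * s) • h3 + (r * r * a * a' * s * s') • h4
    + (r * r * b * b') • h5 + (r * r * b * b' * s') • h6 + (r * r * b * b' * s) • h7
    + (r * r * b * b' * s * s') • h8
    + (r * r * a * b') • k1 + (r * r * a * b' * s') • k2 - (r * r * a * b' * s) • k3
    - (r * r * a * b' * s * s') • k4
    + (r * r * b * a') • k5 - (r * r * b * a' * s') • k6 + (r * r * b * a' * s) • k7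
    - (r * r * b * a' * s * s') • k8

lemma c_mul_conjTranspose_anticomm' {n : ℕ} (i j : Fin (n + 1)) :
    c i * (c j)ᴴ + (c j)ᴴ * c i = (if i = j then 1 else 0 : ℂ) • 1 := by
  rw [c_mul_conjTranspose_anticomm]; split_ifs <;> simp

lemma c_conjTranspose_mul_anticomm' {n : ℕ} (i j : Fin (n + 1)) :
    (c i)ᴴ * c j + c j * (c i)ᴴ = (if i = j then 1 else 0 : ℂ) • 1 := by
  rw [add_comm, c_mul_conjTranspose_anticomm]
  simp only [eq_comm (a := j)]
  split_ifs <;> simp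

lemma bondMode_eq {n : ℕ} (ω : ℝ) (i j : Fin (n + 1)) :
    bondMode ω i j = ((1 / Real.sqrt 2 : ℝ) : ℂ) •
      ((Real.sin (ω / 2) : ℂ) • (c i - (1 : ℂ) • c j) +
        (Real.cos (ω / 2) : ℂ) • ((c i)ᴴ + (1 : ℂ) • (c j)ᴴ)) := by
  rw [bondMode, one_smul, one_smul]

lemma bondMode_conjTranspose {n : ℕ} (ω : ℝ) (i j : Fin (n + 1)) :
    (bondMode ω i j)ᴴ = ((1 / Real.sqrt 2 : ℝ) : ℂ) •
      ((Real.cos (ω / 2) : ℂ) • (c i - (-1 : ℂ) • c j) +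
        (Real.sin (ω / 2) : ℂ) • ((c i)ᴴ + (-1 : ℂ) • (c j)ᴴ)) := by
  simp only [bondMode, Matrix.conjTranspose_smul, Matrix.conjTranspose_add,
    Matrix.conjTranspose_sub, Matrix.conjTranspose_conjTranspose, RCLike.star_def,
    Complex.conj_ofReal]
  module

lemma bondMode_anticomm {n : ℕ} (ω : ℝ) (i j : Fin n) :
    bondMode ω i.castSucc i.succ * bondMode ω j.castSucc j.succ +
      bondMode ω j.castSucc j.succ * bondMode ω i.castSucc i.succ = 0 := by
  rw [bondMode_eq, bondMode_eq, anticommutator_bilinear (c_anticomm _ _) (c_anticomm _ _)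
    (c_anticomm _ _) (c_anticomm _ _) (c_conjTranspose_anticomm _ _)
    (c_conjTranspose_anticomm _ _) (c_conjTranspose_anticomm _ _) (c_conjTranspose_anticomm _ _)
    (c_mul_conjTranspose_anticomm' _ _) (c_mul_conjTranspose_anticomm' _ _)
    (c_mul_conjTranspose_anticomm' _ _) (c_mul_conjTranspose_anticomm' _ _)
    (c_conjTranspose_mul_anticomm' _ _) (c_conjTranspose_mul_anticomm' _ _)
    (c_conjTranspose_mul_anticomm' _ _) (c_conjTranspose_mul_anticomm' _ _)]
  convert zero_smul ℂ (1 : Op n)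
  simp only [Fin.castSucc_inj, Fin.succ_inj]
  ring

/-- The number of end points of one bond that are the opposite end points of another. -/
def bondNeighbours {n : ℕ} (i j : Fin n) : ℝ :=
  (if i.castSucc = j.succ then 1 else 0) + (if i.succ = j.castSucc then 1 else 0)

lemma bondNeighbours_comm {n : ℕ} (i j : Fin n) : bondNeighbours i j = bondNeighbours j i := by
  simp only [bondNeighbours, add_comm, eq_comm]

lemma bondNeighbours_nonneg {n : ℕ} (i j : Fin n) : 0 ≤ bondNeighbours i j := by
  unfold bondNeighbours; positivity

lemma sum_ite_eq_le_one {ι κ : Type*} [Fintype ι] [DecidableEq κ] {f : ι → κ}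
    (hf : Function.Injective f) (a : κ) : ∑ j, (if a = f j then (1 : ℝ) else 0) ≤ 1 := by
  rw [Finset.sum_boole]
  have : (Finset.univ.filter fun j => a = f j).card ≤ 1 :=
    Finset.card_le_one.mpr fun x hx y hy => hf <| by
      rw [← (Finset.mem_filter.mp hx).2, ← (Finset.mem_filter.mp hy).2]
  exact_mod_cast this

lemma sum_bondNeighbours_le {n : ℕ} (i : Fin n) : ∑ j, bondNeighbours i j ≤ 2 := by
  simp only [bondNeighbours, Finset.sum_add_distrib]
  linarith [sum_ite_eq_le_one (Fin.succ_injective n) i.castSucc,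
    sum_ite_eq_le_one (Fin.castSucc_injective n) i.succ]

/-- On the same bond the four contractions give sin² + cos² = 1. Adjacent bonds share one site,
reached with opposite signs by the sine and cosine parts: this gives (cos² - sin²)/2 = cos ω / 2. -/
lemma bondMode_conjTranspose_anticomm {n : ℕ} (ω : ℝ) (i j : Fin n) :
    bondMode ω i.castSucc i.succ * (bondMode ω j.castSucc j.succ)ᴴ +
      (bondMode ω j.castSucc j.succ)ᴴ * bondMode ω i.castSucc i.succ =
      (((if i = j then 1 else 0) + Real.cos ω / 2 * bondNeighbours i j : ℝ) : ℂ) • 1 := by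
  rw [bondMode_eq, bondMode_conjTranspose,
    anticommutator_bilinear (c_anticomm _ _) (c_anticomm _ _)
    (c_anticomm _ _) (c_anticomm _ _) (c_conjTranspose_anticomm _ _)
    (c_conjTranspose_anticomm _ _) (c_conjTranspose_anticomm _ _) (c_conjTranspose_anticomm _ _)
    (c_mul_conjTranspose_anticomm' _ _) (c_mul_conjTranspose_anticomm' _ _)
    (c_mul_conjTranspose_anticomm' _ _) (c_mul_conjTranspose_anticomm' _ _)
    (c_conjTranspose_mul_anticomm' _ _) (c_conjTranspose_mul_anticomm' _ _)
    (c_conjTranspose_mul_anticomm' _ _) (c_conjTranspose_mul_anticomm' _ _)]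
  congr 1
  have h2 := inv_sqrt_two_mul_self
  have hcs := cos_half_mul_self ω
  have hcos := cos_eq_one_sub ω
  rw [h2, bondNeighbours]
  simp only [Fin.castSucc_inj, Fin.succ_inj, Complex.ofReal_add, Complex.ofReal_mul,
    Complex.ofReal_div, hcos]
  generalize (Real.cos (ω / 2) : ℂ) = C at *
  generalize (Real.sin (ω / 2) : ℂ) = S at *
  simp only [apply_ite Complex.ofReal, Complex.ofReal_one, Complex.ofReal_zero,
    Complex.ofReal_ofNat]
  linear_combination ((if i = j then 1 else 0) + ((if i.castSucc = j.succ then 1 else 0) +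
    (if i.succ = j.castSucc then 1 else 0)) / 2) * hcs

/-! ### Gap estimates in an abstract Hilbert space -/

section Abstract

variable {V : Type*} [NormedAddCommGroup V] [InnerProductSpace ℂ V]

local notation "⟪" x ", " y "⟫" => inner ℂ x y

/-- A Gershgorin-type bound: each inner product is at most half the sum of the two squared norms,
and the rows of `N` sum to at most 2. -/
lemma sum_coupling_ge {ι : Type*} [Fintype ι] (N : ι → ι → ℝ) (hN : ∀ i j, 0 ≤ N i j)
    (hsymm : ∀ i j, N i j = N j i) (hsum : ∀ i, ∑ j, N i j ≤ 2) (g : ℝ) (f : ι → V) :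
    -(2 * |g|) * ∑ i, ‖f i‖ ^ 2 ≤ ∑ i, ∑ j, g * N i j * (⟪f i, f j⟫).re := by
  have h1 : ∀ i j, -(|g| * N i j * ((‖f i‖ ^ 2 + ‖f j‖ ^ 2) / 2)) ≤
      g * N i j * (⟪f i, f j⟫).re := by
    intro i j
    have ha : |(⟪f i, f j⟫).re| ≤ (‖f i‖ ^ 2 + ‖f j‖ ^ 2) / 2 := by
      refine ((Complex.abs_re_le_norm _).trans (norm_inner_le_norm _ _)).trans ?_
      nlinarith [sq_nonneg (‖f i‖ - ‖f j‖)]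
    have hb : |g * N i j * (⟪f i, f j⟫).re| ≤
        |g| * N i j * ((‖f i‖ ^ 2 + ‖f j‖ ^ 2) / 2) := by
      rw [abs_mul, abs_mul, abs_of_nonneg (hN i j)]
      exact mul_le_mul_of_nonneg_left ha (mul_nonneg (abs_nonneg _) (hN i j))
    exact (abs_le.mp hb).1
  refine le_trans ?_ (Finset.sum_le_sum fun i _ => Finset.sum_le_sum fun j _ => h1 i j)
  have h2 : ∑ i, ∑ j, N i j * ‖f j‖ ^ 2 = ∑ i, ∑ j, N i j * ‖f i‖ ^ 2 := by
    rw [Finset.sum_comm]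
    simp only [hsymm]
  have h3 : ∑ i, ∑ j, N i j * ‖f i‖ ^ 2 ≤ 2 * ∑ i, ‖f i‖ ^ 2 := by
    rw [Finset.mul_sum]
    refine Finset.sum_le_sum fun i _ => ?_
    rw [← Finset.sum_mul]
    exact mul_le_mul_of_nonneg_right (hsum i) (by positivity)
  have h4 : ∑ i, ∑ j, -(|g| * N i j * ((‖f i‖ ^ 2 + ‖f j‖ ^ 2) / 2)) =
      -(|g| / 2) * (∑ i, ∑ j, N i j * ‖f i‖ ^ 2 + ∑ i, ∑ j, N i j * ‖f j‖ ^ 2) := by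
    simp only [← Finset.sum_add_distrib, Finset.mul_sum]
    refine Finset.sum_congr rfl fun i _ => Finset.sum_congr rfl fun j _ => ?_
    ring
  rw [h4, h2]
  nlinarith [mul_le_mul_of_nonneg_left h3 (abs_nonneg g)]

variable [CompleteSpace V]

/-- This is K² ≥ (1 - 2|g|) K for K = Σ D†D. In the expansion of ‖Kv‖² the anticommutation relations
turn every quartic term into a square, which can be dropped; the quadratic terms are the diagonal
plus the coupling. -/
lemma norm_sum_adjoint_sq_ge {ι : Type*} [Fintype ι] [DecidableEq ι] (D : ι → V →L[ℂ] V)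
    (N : ι → ι → ℝ) (hN : ∀ i j, 0 ≤ N i j) (hsymm : ∀ i j, N i j = N j i)
    (hsum : ∀ i, ∑ j, N i j ≤ 2) (g : ℝ)
    (hD : ∀ i j, D i * D j + D j * D i = 0)
    (hD' : ∀ i j, D i * star (D j) + star (D j) * D i =
      (((if i = j then 1 else 0) + g * N i j : ℝ) : ℂ) • 1) (v : V) :
    (1 - 2 * |g|) * ∑ i, ‖D i v‖ ^ 2 ≤ ‖(∑ i, star (D i) * D i) v‖ ^ 2 := by
  have hadj : ∀ i x y, ⟪star (D i) x, y⟫ = ⟪x, D i y⟫ := fun i x y =>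
    ContinuousLinearMap.adjoint_inner_left _ _ _
  have hadj' : ∀ i x y, ⟪x, star (D i) y⟫ = ⟪D i x, y⟫ := fun i x y =>
    ContinuousLinearMap.adjoint_inner_right _ _ _
  -- Move D_i past D_j†, then exchange D_i and D_j: the two signs cancel and leave +‖D_j D_i v‖².
  have hterm : ∀ i j, (⟪(star (D i) * D i) v, (star (D j) * D j) v⟫).re =
      ((if i = j then 1 else 0) + g * N i j) * (⟪D i v, D j v⟫).re + ‖D j (D i v)‖ ^ 2 := by
    intro i j
    have e1 : D i (star (D j) (D j v)) = (((if i = j then 1 else 0) + g * N i j : ℝ) : ℂ) • D j v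
        - star (D j) (D i (D j v)) := by
      rw [eq_sub_iff_add_eq]
      exact congrArg (fun T : V →L[ℂ] V => T (D j v)) (hD' i j)
    have e2 : D i (D j v) = -D j (D i v) :=
      eq_neg_of_add_eq_zero_left (congrArg (fun T : V →L[ℂ] V => T v) (hD i j))
    rw [mul_apply_eq_comp, mul_apply_eq_comp, hadj, e1, inner_sub_right,
      hadj', e2, inner_neg_right, inner_smul_right, sub_neg_eq_add, Complex.add_re,
      Complex.re_ofReal_mul, inner_self_eq_norm_sq_to_K]
    norm_cast
  have hsq : ‖(∑ i, star (D i) * D i) v‖ ^ 2 =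
      ∑ i, ∑ j, (⟪(star (D i) * D i) v, (star (D j) * D j) v⟫).re := by
    rw [← @inner_self_eq_norm_sq ℂ, sum_apply, sum_inner]
    simp only [inner_sum, map_sum]
    rfl
  have hdiag : ∑ i, ∑ j, (if i = j then (1 : ℝ) else 0) * (⟪D i v, D j v⟫).re =
      ∑ i, ‖D i v‖ ^ 2 := by
    refine Finset.sum_congr rfl fun i _ => ?_
    simp only [ite_mul, one_mul, zero_mul, Finset.sum_ite_eq, Finset.mem_univ, if_true]
    exact @inner_self_eq_norm_sq ℂ _ _ _ _ _
  have hpos : 0 ≤ ∑ i, ∑ j, ‖D j (D i v)‖ ^ 2 := by positivity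
  have hoff := sum_coupling_ge N hN hsymm hsum g fun i => D i v
  rw [hsq]
  simp only [hterm, add_mul, Finset.sum_add_distrib, hdiag]
  linarith

/-- If `K₀ ≥ 0` has spectral gap `γ`, `K ≥ m K₀`, and `K` vanishes on the kernel of `K₀`, then every
nonzero eigenvalue of `K` is at least `m γ`. -/
lemma eigenvalue_ge_of_gap [FiniteDimensional ℂ V] {K₀ K : V →L[ℂ] V} (hK₀ : IsSelfAdjoint K₀)
    (hK : IsSelfAdjoint K) (hker : ∀ v, K₀ v = 0 → K v = 0) {m γ : ℝ} (hm : 0 ≤ m) (hγ : 0 < γ)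
    (hpos : ∀ v, 0 ≤ (⟪v, K₀ v⟫).re) (hle : ∀ v, m * (⟪v, K₀ v⟫).re ≤ (⟪v, K v⟫).re)
    (hgap : ∀ v, γ * (⟪v, K₀ v⟫).re ≤ ‖K₀ v‖ ^ 2) {v : V} (hv : v ≠ 0) {r : ℝ} (hr : r ≠ 0)
    (hev : K v = (r : ℂ) • v) : m * γ ≤ r := by
  have hsym₀ : ∀ x y, ⟪K₀ x, y⟫ = ⟪x, K₀ y⟫ := hK₀.isSymmetric
  have hsym : ∀ x y, ⟪K x, y⟫ = ⟪x, K y⟫ := hK.isSymmetric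
  -- An eigenvector of `K` for `r ≠ 0` is orthogonal to the kernel of `K₀`, on which `K` vanishes,
  -- hence lies in the range of `K₀`.
  have hrange : v ∈ K₀.range := by
    have h1 : K₀.rangeᗮ = K₀.ker := by
      rw [ContinuousLinearMap.orthogonal_range, hK₀.adjoint_eq]
    rw [← Submodule.orthogonal_orthogonal K₀.range, h1, Submodule.mem_orthogonal]
    intro u hu
    have h2 : (r : ℂ) * ⟪u, v⟫ = 0 := by
      rw [← inner_smul_right, ← hev, ← hsym, hker u hu, inner_zero_left]
    exact (mul_eq_zero.mp h2).resolve_left (by exact_mod_cast hr)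
  obtain ⟨w, hw⟩ := hrange
  change K₀ w = v at hw
  have hw1 : γ * (⟪w, v⟫).re ≤ ‖v‖ ^ 2 := by simpa [hw] using hgap w
  -- Positivity of `K₀` at v - γw, with K₀w = v and γ⟨w, v⟩ ≤ ‖v‖², yields ⟨v, K₀v⟩ ≥ γ‖v‖² without
  -- diagonalising `K₀`.
  have hexp : (⟪v - (γ : ℂ) • w, K₀ (v - (γ : ℂ) • w)⟫).re =
      (⟪v, K₀ v⟫).re - 2 * γ * ‖v‖ ^ 2 + γ * (γ * (⟪w, v⟫).re) := by
    have h3 : ⟪v, v⟫.re = ‖v‖ ^ 2 := @inner_self_eq_norm_sq ℂ _ _ _ _ v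
    have h4 : ⟪w, K₀ v⟫ = ⟪v, v⟫ := by rw [← hsym₀, hw]
    simp only [map_sub, map_smul, hw, inner_sub_left, inner_sub_right, inner_smul_left,
      inner_smul_right, h4, Complex.conj_ofReal, Complex.sub_re, Complex.re_ofReal_mul, h3]
    ring
  have h5 := hpos (v - (γ : ℂ) • w)
  have h6 : γ * ‖v‖ ^ 2 ≤ (⟪v, K₀ v⟫).re := by
    rw [hexp] at h5
    nlinarith [mul_le_mul_of_nonneg_left hw1 hγ.le]
  have h7 : (⟪v, K v⟫).re = r * ‖v‖ ^ 2 := by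
    rw [hev, inner_smul_right, Complex.re_ofReal_mul]
    congr 1
    exact @inner_self_eq_norm_sq ℂ _ _ _ _ v
  have h8 : 0 < ‖v‖ ^ 2 := by positivity
  have h9 := hle v
  rw [h7] at h9
  have := mul_le_mul_of_nonneg_left h6 hm
  exact le_of_mul_le_mul_right (by linarith) h8

end Abstract

/-! ### Bond parity and the parent operator -/

lemma siteOp_mul_self_site {n : ℕ} (j : Fin (n + 1)) (B D : Matrix (Fin 2) (Fin 2) ℂ) :
    (siteOp j B * siteOp j D : Op n) = siteOp j (B * D) := by
  rw [siteOp, siteOp, siteOp, tensorOp_mul]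
  congr 1
  funext k
  by_cases hk : k = j
  · subst hk; simp
  · simp [Function.update_of_ne hk]

lemma siteOp_commute {n : ℕ} {i j : Fin (n + 1)} (hij : i ≠ j)
    (B D : Matrix (Fin 2) (Fin 2) ℂ) :
    (siteOp i B * siteOp j D : Op n) = siteOp j D * siteOp i B := by
  rw [siteOp, siteOp, tensorOp_mul, tensorOp_mul]
  congr 1
  funext k
  by_cases hk : k = j
  · subst hk; simp [Function.update_of_ne hij.symm]
  · simp [Function.update_of_ne hk]

lemma siteOp_conjTranspose {n : ℕ} (j : Fin (n + 1)) (B : Matrix (Fin 2) (Fin 2) ℂ) :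
    (siteOp j B : Op n)ᴴ = siteOp j Bᴴ := by
  rw [siteOp, siteOp, tensorOp_conjTranspose]
  congr 1
  funext k
  by_cases hk : k = j
  · subst hk; simp
  · simp [Function.update_of_ne hk]

lemma two_num_sub_one {n : ℕ} (j : Fin (n + 1)) :
    ((2 : ℝ) • num j - 1 : Op n) = siteOp j (-pauliZ) := by
  have h : -pauliZ = (2 : ℂ) • (loweringᴴ * lowering) + (-1 : ℂ) • 1 := by
    rw [lowering_conjTranspose]
    ext a b
    fin_cases a <;> fin_cases b <;> norm_num [pauliZ, lowering]
  have hr : ((2 : ℝ) • num j : Op n) = (2 : ℂ) • num j := by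
    ext x y; simp
  rw [h, siteOp_add, siteOp_smul, siteOp_smul, siteOp_one, hr, num, c_conjTranspose,
    c_eq_jordanWigner, jordanWigner_mul_self_site]
  module

lemma bondParity_eq {n : ℕ} (i j : Fin (n + 1)) :
    bondParity i j = (siteOp i (-pauliZ) * siteOp j (-pauliZ) : Op n) := by
  rw [bondParity, two_num_sub_one, two_num_sub_one]

lemma bondParity_conjTranspose {n : ℕ} {i j : Fin (n + 1)} (hij : i ≠ j) :
    (bondParity i j : Op n)ᴴ = bondParity i j := by
  rw [bondParity_eq, Matrix.conjTranspose_mul, siteOp_conjTranspose, siteOp_conjTranspose,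
    Matrix.conjTranspose_neg, pauliZ_conjTranspose, siteOp_commute hij]

lemma bondParity_mul_self {n : ℕ} {i j : Fin (n + 1)} (hij : i ≠ j) :
    (bondParity i j * bondParity i j : Op n) = 1 := by
  have h (k : Fin (n + 1)) : (siteOp k (-pauliZ) * siteOp k (-pauliZ) : Op n) = 1 := by
    rw [siteOp_mul_self_site, neg_mul_neg, pauliZ_mul_pauliZ, siteOp_one]
  rw [bondParity_eq]
  nth_rewrite 2 [siteOp_commute hij]
  rw [mul_assoc, ← mul_assoc (siteOp j _) (siteOp j _), h, one_mul, h]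

/-- The frustration-free part of the Hamiltonian `Hs`, up to the factor `4 A`. -/
def parentOp (ω s : ℝ) (n : ℕ) : Op n :=
  ∑ i : Fin n, (bondMode ω i.castSucc i.succ)ᴴ *
    (((1 + s : ℝ) : ℂ) • (1 : Op n) - (s : ℂ) • bondParity i.castSucc i.succ) *
      bondMode ω i.castSucc i.succ

lemma Hs_eq (A ω s : ℝ) (n : ℕ) :
    Hs A ω s n = ((-2 * A * (1 + s) * n : ℝ) : ℂ) • (1 : Op n) +
      ((4 * A : ℝ) : ℂ) • parentOp ω s n := by
  have hr (r : ℝ) (M : Op n) : r • M = (r : ℂ) • M := by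
    ext x y; simp
  simp only [Hs, dimer_eq, parentOp, hr, Finset.sum_add_distrib, Finset.smul_sum]
  congr 1
  rw [Finset.sum_const, Finset.card_univ, Fintype.card_fin, ← Nat.cast_smul_eq_nsmul ℂ,
    smul_smul]
  congr 1
  push_cast
  ring

lemma parentOp_isHermitian (ω s : ℝ) (n : ℕ) : (parentOp ω s n).IsHermitian := by
  rw [Matrix.IsHermitian, parentOp, Matrix.conjTranspose_sum]
  refine Finset.sum_congr rfl fun i _ => ?_
  simp only [Matrix.conjTranspose_mul, Matrix.conjTranspose_sub, Matrix.conjTranspose_smul,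
    Matrix.conjTranspose_conjTranspose, Matrix.conjTranspose_one, RCLike.star_def,
    Complex.conj_ofReal, bondParity_conjTranspose (Fin.castSucc_lt_succ (i := i)).ne, mul_assoc]

lemma Hs_isHermitian (A ω s : ℝ) (n : ℕ) : (Hs A ω s n).IsHermitian := by
  rw [Matrix.IsHermitian, Hs_eq]
  simp only [Matrix.conjTranspose_add, Matrix.conjTranspose_smul, Matrix.conjTranspose_one,
    RCLike.star_def, Complex.conj_ofReal, (parentOp_isHermitian ω s n).eq]

/-! ### Positivity, kernel and gap of the parent operator -/

section Gap

local notation "⟪" x ", " y "⟫" => inner ℂ x y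

/-- A self-adjoint involution is an isometry, so Cauchy-Schwarz suffices. -/
lemma abs_re_inner_le_of_involution {V : Type*} [NormedAddCommGroup V] [InnerProductSpace ℂ V]
    [CompleteSpace V] {W : V →L[ℂ] V} (hW : star W = W) (hW2 : W * W = 1) (f : V) :
    |(⟪f, W f⟫).re| ≤ ‖f‖ ^ 2 := by
  have h : ‖W f‖ ^ 2 = ‖f‖ ^ 2 := by
    have h1 : ⟪W f, W f⟫ = ⟪f, f⟫ := by
      conv_lhs => rw [← hW]
      rw [ContinuousLinearMap.star_eq_adjoint, ContinuousLinearMap.adjoint_inner_left,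
        ← ContinuousLinearMap.star_eq_adjoint, hW, ← mul_apply_eq_comp, hW2]
      rfl
    rw [← @inner_self_eq_norm_sq ℂ, ← @inner_self_eq_norm_sq ℂ, h1]
  have h2 : ‖W f‖ = ‖f‖ := by
    rwa [sq_eq_sq₀ (norm_nonneg _) (norm_nonneg _)] at h
  refine ((Complex.abs_re_le_norm _).trans (norm_inner_le_norm _ _)).trans ?_
  rw [h2, sq]

/-- Operators on the Euclidean space of states. -/
abbrev toCLM {n : ℕ} : Op n ≃⋆ₐ[ℂ]
    (EuclideanSpace ℂ (Config n) →L[ℂ] EuclideanSpace ℂ (Config n)) :=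
  Matrix.toEuclideanCLM (n := Config n) (𝕜 := ℂ)

lemma inner_parentOp {n : ℕ} (ω s : ℝ) (v : EuclideanSpace ℂ (Config n)) :
    (⟪v, toCLM (parentOp ω s n) v⟫).re =
      ∑ i : Fin n, ((1 + s) * ‖toCLM (bondMode ω i.castSucc i.succ) v‖ ^ 2 -
        s * (⟪toCLM (bondMode ω i.castSucc i.succ) v, toCLM (bondParity i.castSucc i.succ)
          (toCLM (bondMode ω i.castSucc i.succ) v)⟫).re) := by
  rw [parentOp, map_sum, sum_apply, inner_sum, Complex.re_sum]
  refine Finset.sum_congr rfl fun i _ => ?_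
  generalize bondMode ω i.castSucc i.succ = d
  generalize bondParity i.castSucc i.succ = W
  rw [← Matrix.star_eq_conjTranspose, map_mul, map_mul, map_star, map_sub, map_smul, map_smul,
    map_one, mul_apply_eq_comp, mul_apply_eq_comp, ContinuousLinearMap.star_eq_adjoint,
    ContinuousLinearMap.adjoint_inner_right]
  generalize toCLM d v = f
  have h1 : ⟪f, f⟫.re = ‖f‖ ^ 2 := @inner_self_eq_norm_sq ℂ _ _ _ _ f
  simp only [sub_apply, smul_apply,
    one_apply_eq_self, inner_sub_right, inner_smul_right, Complex.sub_re,
    Complex.re_ofReal_mul, h1]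

lemma inner_parentOp_zero {n : ℕ} (ω : ℝ) (v : EuclideanSpace ℂ (Config n)) :
    (⟪v, toCLM (parentOp ω 0 n) v⟫).re =
      ∑ i : Fin n, ‖toCLM (bondMode ω i.castSucc i.succ) v‖ ^ 2 := by
  rw [inner_parentOp]
  simp

/-- Bond by bond, (1+s) - sW lies between 1 and 1 + 2s; the sign of s decides which end is the lower
one. -/
lemma inner_parentOp_ge {n : ℕ} (ω s : ℝ) (v : EuclideanSpace ℂ (Config n)) :
    min 1 (1 + 2 * s) * ∑ i : Fin n, ‖toCLM (bondMode ω i.castSucc i.succ) v‖ ^ 2 ≤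
      (⟪v, toCLM (parentOp ω s n) v⟫).re := by
  rw [inner_parentOp, Finset.mul_sum]
  refine Finset.sum_le_sum fun i _ => ?_
  have hne := (Fin.castSucc_lt_succ (i := i)).ne
  have hW : star (toCLM (bondParity i.castSucc i.succ)) =
      toCLM (bondParity i.castSucc i.succ) := by
    rw [← map_star, Matrix.star_eq_conjTranspose, bondParity_conjTranspose hne]
  have hW2 : toCLM (bondParity i.castSucc i.succ) * toCLM (bondParity i.castSucc i.succ) = 1 := by
    rw [← map_mul, bondParity_mul_self hne, map_one]
  have h := abs_le.mp (abs_re_inner_le_of_involution hW hW2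
    (toCLM (bondMode ω i.castSucc i.succ) v))
  have hf := sq_nonneg ‖toCLM (bondMode ω i.castSucc i.succ) v‖
  rcases le_total 0 s with hs | hs
  · rw [min_eq_left (by linarith)]
    nlinarith [mul_le_mul_of_nonneg_left h.2 hs]
  · rw [min_eq_right (by linarith)]
    nlinarith [mul_le_mul_of_nonpos_left h.1 hs]

lemma parentOp_mulVec_eq_zero_of_bondMode {n : ℕ} {ω : ℝ} {ψ : State n}
    (h : ∀ i : Fin n, bondMode ω i.castSucc i.succ *ᵥ ψ = 0) (s : ℝ) :
    parentOp ω s n *ᵥ ψ = 0 := by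
  rw [parentOp, Matrix.sum_mulVec]
  refine Finset.sum_eq_zero fun i _ => ?_
  rw [← Matrix.mulVec_mulVec, h, Matrix.mulVec_zero]

/-- Frustration-freeness: a zero expectation value bounds a positive multiple of Σ‖dψ‖², so every
term vanishes. The multiple is positive because s > -1/2. -/
lemma bondMode_mulVec_eq_zero_of_parentOp {n : ℕ} {ω s : ℝ} (hs : -1 / 2 < s) {ψ : State n}
    (h : parentOp ω s n *ᵥ ψ = 0) (i : Fin n) : bondMode ω i.castSucc i.succ *ᵥ ψ = 0 := by
  have h1 := inner_parentOp_ge ω s (WithLp.toLp 2 ψ)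
  rw [Matrix.toEuclideanCLM_toLp, h, WithLp.toLp_zero, inner_zero_right, Complex.zero_re] at h1
  have hm : 0 < min 1 (1 + 2 * s) := lt_min one_pos (by linarith)
  have h2 : ∑ i : Fin n, ‖toCLM (bondMode ω i.castSucc i.succ) (WithLp.toLp 2 ψ)‖ ^ 2 ≤ 0 :=
    nonpos_of_mul_nonpos_right h1 hm
  have h3 := (Finset.sum_eq_zero_iff_of_nonneg fun j _ => sq_nonneg _).mp
    (le_antisymm h2 (Finset.sum_nonneg fun j _ => sq_nonneg _)) i (Finset.mem_univ i)
  rw [sq_eq_zero_iff, norm_eq_zero, Matrix.toEuclideanCLM_toLp] at h3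
  simpa using h3

lemma parentOp_mulVec_eq_zero_iff {n : ℕ} {ω s : ℝ} (hs : -1 / 2 < s) {ψ : State n} :
    parentOp ω s n *ᵥ ψ = 0 ↔ ∀ i : Fin n, bondMode ω i.castSucc i.succ *ᵥ ψ = 0 :=
  ⟨bondMode_mulVec_eq_zero_of_parentOp hs, fun h => parentOp_mulVec_eq_zero_of_bondMode h s⟩

lemma parentOp_eigenvalue_nonneg {n : ℕ} {ω s : ℝ} (hs : -1 / 2 < s) {ψ : State n} (hψ : ψ ≠ 0)
    {r : ℝ} (h : parentOp ω s n *ᵥ ψ = (r : ℂ) • ψ) : 0 ≤ r := by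
  have h1 := inner_parentOp_ge ω s (WithLp.toLp 2 ψ)
  have hm : 0 < min 1 (1 + 2 * s) := lt_min one_pos (by linarith)
  have h0 : 0 ≤ (⟪WithLp.toLp 2 ψ, toCLM (parentOp ω s n) (WithLp.toLp 2 ψ)⟫).re :=
    le_trans (mul_nonneg hm.le (Finset.sum_nonneg fun j _ => sq_nonneg _)) h1
  have h2 : 0 < ‖WithLp.toLp 2 ψ‖ ^ 2 := by
    have : WithLp.toLp 2 ψ ≠ 0 := by simpa using hψ
    positivity
  rw [Matrix.toEuclideanCLM_toLp, h, WithLp.toLp_smul, inner_smul_right, Complex.re_ofReal_mul,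
    show (⟪WithLp.toLp 2 ψ, WithLp.toLp 2 ψ⟫).re = ‖WithLp.toLp 2 ψ‖ ^ 2 from
      @inner_self_eq_norm_sq ℂ _ _ _ _ _] at h0
  exact nonneg_of_mul_nonneg_left h0 h2

lemma isSelfAdjoint_toCLM_parentOp (ω s : ℝ) (n : ℕ) :
    IsSelfAdjoint (toCLM (parentOp ω s n)) := by
  rw [IsSelfAdjoint, ← map_star, Matrix.star_eq_conjTranspose, (parentOp_isHermitian ω s n).eq]

/-- The quadratic operator at s = 0 is the reference: its gap comes from the anticommutators, and
its kernel is that of every other s. -/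
lemma parentOp_eigenvalue_ge {n : ℕ} {ω s : ℝ} (hs : -1 / 2 < s) (hω : |Real.cos ω| < 1)
    {ψ : State n} (hψ : ψ ≠ 0) {r : ℝ} (hr : r ≠ 0)
    (h : parentOp ω s n *ᵥ ψ = (r : ℂ) • ψ) :
    min 1 (1 + 2 * s) * (1 - |Real.cos ω|) ≤ r := by
  refine eigenvalue_ge_of_gap (isSelfAdjoint_toCLM_parentOp ω 0 n)
    (isSelfAdjoint_toCLM_parentOp ω s n) ?_ (le_min zero_le_one (by linarith))
    (sub_pos.mpr hω) ?_ ?_ ?_ (v := WithLp.toLp 2 ψ) (by simpa using hψ) hr ?_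
  · intro v hv
    have hv' : parentOp ω 0 n *ᵥ WithLp.ofLp v = 0 := by
      rw [← Matrix.ofLp_toEuclideanCLM, hv]; rfl
    rw [parentOp_mulVec_eq_zero_iff (by norm_num), ← parentOp_mulVec_eq_zero_iff hs,
      ← Matrix.ofLp_toEuclideanCLM] at hv'
    exact (WithLp.ofLp_eq_zero 2).mp hv'
  · intro v
    rw [inner_parentOp_zero]
    positivity
  · intro v
    rw [inner_parentOp_zero]
    exact inner_parentOp_ge ω s v
  · intro v
    rw [inner_parentOp_zero]
    have hK : toCLM (parentOp ω 0 n) = ∑ i : Fin n,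
        star (toCLM (bondMode ω i.castSucc i.succ)) * toCLM (bondMode ω i.castSucc i.succ) := by
      rw [parentOp, map_sum]
      refine Finset.sum_congr rfl fun i _ => ?_
      rw [← map_star, ← map_mul, Matrix.star_eq_conjTranspose]
      congr 1
      simp
    -- The coupling between adjacent bonds is g = cos ω / 2.
    have hg : 1 - |Real.cos ω| = 1 - 2 * |Real.cos ω / 2| := by
      rw [abs_div, abs_two]; ring
    rw [hK, hg]
    refine norm_sum_adjoint_sq_ge _ bondNeighbours bondNeighbours_nonneg bondNeighbours_comm
      sum_bondNeighbours_le _ (fun i j => ?_) (fun i j => ?_) v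
    · rw [← map_mul, ← map_mul, ← map_add, bondMode_anticomm, map_zero]
    · rw [← map_star, ← map_mul, ← map_mul, ← map_add, Matrix.star_eq_conjTranspose,
        bondMode_conjTranspose_anticomm, map_smul, map_one]
  · rw [Matrix.toEuclideanCLM_toLp, h, WithLp.toLp_smul]

end Gap

/-! ### The common kernel of the bond modes -/

-- The product form evaluates product states; the additive form compares weights.
@[to_additive]
lemma prod_setPair {n : ℕ} {M : Type*} [CommMonoid M] (f : Fin (n + 1) → Fin 2 → M)
    {i j : Fin (n + 1)} (hij : i ≠ j) (x : Config n) (a b : Fin 2) :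
    ∏ k, f k (setPair i j x a b k) =
      f i a * f j b * ∏ k ∈ (Finset.univ.erase i).erase j, f k (x k) := by
  rw [← Finset.mul_prod_erase _ _ (Finset.mem_univ i),
    ← Finset.mul_prod_erase _ _ (Finset.mem_erase.mpr ⟨hij.symm, Finset.mem_univ j⟩), ← mul_assoc]
  congr 1
  · simp [setPair, Function.update_of_ne hij]
  · refine Finset.prod_congr rfl fun k hk => ?_
    obtain ⟨h1, h2, -⟩ := by simpa only [Finset.mem_erase] using hk
    rw [setPair, Function.update_of_ne h1, Function.update_of_ne h2]

lemma bondMode_mulVec_productState {n : ℕ} {ω : ℝ} {v : Fin 2 → ℂ}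
    (hv : Real.sin (ω / 2) * v 1 ^ 2 + Real.cos (ω / 2) * v 0 ^ 2 = 0) (i : Fin n) :
    bondMode ω i.castSucc i.succ *ᵥ productState n v = 0 := by
  funext x
  rw [← setPair_self i.castSucc i.succ x, bondMode_mulVec_setPair]
  simp only [productState,
    prod_setPair (fun _ => v) (Fin.castSucc_lt_succ (i := i)).ne, Pi.zero_apply]
  generalize x i.castSucc = a
  generalize x i.succ = b
  generalize ∏ k ∈ (Finset.univ.erase i.castSucc).erase i.succ, v (x k) = R
  generalize ((1 / Real.sqrt 2 : ℝ) : ℂ) * stringSign i.castSucc x = r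
  fin_cases a <;> fin_cases b <;>
    simp only [Fin.zero_eta, Fin.mk_one, if_true, one_ne_zero, if_false, pauliZ, Matrix.of_apply,
      Matrix.cons_val', Matrix.cons_val_zero, Matrix.cons_val_one, Matrix.cons_val_fin_one]
  · ring
  · linear_combination r * R * hv
  · linear_combination r * R * hv
  · ring

/-- These are the components of dψ = 0 at 00 and 01 on the bond; those at 10 and 11 impose nothing
new. -/
lemma swap_of_bondMode_mulVec_eq_zero {n : ℕ} {ω : ℝ} (hS : Real.sin (ω / 2) ≠ 0) {ψ : State n}
    {i : Fin n} (h : bondMode ω i.castSucc i.succ *ᵥ ψ = 0) (x : Config n) :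
    ψ (setPair i.castSucc i.succ x 0 1) = ψ (setPair i.castSucc i.succ x 1 0) ∧
      Real.sin (ω / 2) * ψ (setPair i.castSucc i.succ x 1 1) +
        Real.cos (ω / 2) * ψ (setPair i.castSucc i.succ x 0 0) = 0 := by
  have hr : ((1 / Real.sqrt 2 : ℝ) : ℂ) * stringSign i.castSucc x ≠ 0 := by
    refine mul_ne_zero ?_ (left_ne_zero_of_mul_eq_one (stringSign_mul_self i.castSucc x))
    exact_mod_cast one_div_ne_zero (Real.sqrt_ne_zero'.mpr two_pos)
  have hS' : (Real.sin (ω / 2) : ℂ) ≠ 0 := by exact_mod_cast hS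
  have h00 := bondMode_mulVec_setPair i ψ x 0 0 ω
  have h01 := bondMode_mulVec_setPair i ψ x 0 1 ω
  rw [h, Pi.zero_apply, eq_comm, mul_eq_zero, or_iff_right hr] at h00 h01
  simp only [if_true, one_ne_zero, if_false, pauliZ, Matrix.of_apply, Matrix.cons_val',
    Matrix.cons_val_zero, Matrix.cons_val_fin_one] at h00 h01
  constructor
  · have : (Real.sin (ω / 2) : ℂ) * (ψ (setPair i.castSucc i.succ x 1 0) -
        ψ (setPair i.castSucc i.succ x 0 1)) = 0 := by linear_combination h00
    exact (sub_eq_zero.mp ((mul_eq_zero.mp this).resolve_left hS')).symm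
  · linear_combination h01

/-- The sum of the positions (counted from `1`) of the sites in state `|1⟩`. -/
def weight {n : ℕ} (x : Config n) : ℕ := ∑ k : Fin (n + 1), ((k : ℕ) + 1) * (x k : ℕ)

/-- Induction on the weight. A 1 beyond the first site either moves one step left or, if its left
neighbour is 1, is deleted with it; both lower the weight. What remains is the empty configuration
or a single 1 on the first site. -/
lemma eq_zero_of_bondMode_mulVec_eq_zero {n : ℕ} {ω : ℝ} (hS : Real.sin (ω / 2) ≠ 0)
    {ψ : State n} (h : ∀ i : Fin n, bondMode ω i.castSucc i.succ *ᵥ ψ = 0)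
    (h0 : ψ 0 = 0) (h1 : ψ (Function.update 0 0 1) = 0) : ψ = 0 := by
  suffices ∀ N, ∀ x : Config n, weight x = N → ψ x = 0 from funext fun x => this _ x rfl
  intro N
  induction N using Nat.strong_induction_on with
  | _ N ih =>
  intro x hx
  by_cases hex : ∃ i : Fin n, x i.succ = 1
  · obtain ⟨i, hi⟩ := hex
    obtain ⟨hswap, hpair⟩ := swap_of_bondMode_mulVec_eq_zero hS (h i) x
    have hw (a b : Fin 2) :=
      sum_setPair (fun (k : Fin (n + 1)) (d : Fin 2) => ((k : ℕ) + 1) * (d : ℕ))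
            (Fin.castSucc_lt_succ (i := i)).ne x a b
    have hxx := setPair_self i.castSucc i.succ x
    rw [hi] at hxx
    have hlow (a b : Fin 2) (hab : weight (setPair i.castSucc i.succ x a b) < N) :
        ψ (setPair i.castSucc i.succ x a b) = 0 := ih _ hab _ rfl
    have hx' : weight (setPair i.castSucc i.succ x (x i.castSucc) 1) = N := by rw [hxx, hx]
    rw [← hxx]
    generalize x i.castSucc = a at *
    fin_cases a
    · refine hswap.trans (hlow 1 0 ?_)
      rw [← hx', weight, weight, hw, hw]
      simp
    · have h00 : ψ (setPair i.castSucc i.succ x 0 0) = 0 := by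
        refine hlow 0 0 ?_
        rw [← hx', weight, weight, hw, hw]
        simp
      rw [h00, mul_zero, add_zero] at hpair
      exact (mul_eq_zero.mp hpair).resolve_left (by exact_mod_cast hS)
  · push Not at hex
    have hz (i : Fin n) : x i.succ = 0 := by
      have := hex i
      generalize x i.succ = a at *
      fin_cases a <;> simp_all
    have hx0 : x = Function.update (0 : Config n) 0 (x 0) := by
      funext k
      refine Fin.cases ?_ (fun i => ?_) k
      · simp
      · rw [hz, Function.update_of_ne (Fin.succ_ne_zero i), Pi.zero_apply]
    rw [hx0]
    generalize x 0 = a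
    fin_cases a
    · simpa using h0
    · simpa using h1

lemma productState_zero (n : ℕ) (v : Fin 2 → ℂ) : productState n v 0 = v 0 ^ (n + 1) := by
  simp [productState]

lemma productState_update_zero (n : ℕ) (v : Fin 2 → ℂ) :
    productState n v (Function.update 0 0 1) = v 1 * v 0 ^ n := by
  rw [productState, Fin.prod_univ_succ]
  simp

/-- The common kernel of the bond modes is spanned by the two product states. -/
lemma mem_productSpan_iff {n : ℕ} {θ ω : ℝ} (hc : Real.cos (θ / 2) ≠ 0)
    (hs : Real.sin (θ / 2) ≠ 0) (hS : Real.sin (ω / 2) ≠ 0)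
    (hrel : Real.sin (ω / 2) * Real.sin (θ / 2) ^ 2 = Real.cos (ω / 2) * Real.cos (θ / 2) ^ 2)
    {ψ : State n} :
    ψ ∈ productSpan θ n ↔ ∀ i : Fin n, bondMode ω i.castSucc i.succ *ᵥ ψ = 0 := by
  have hrel' : (Real.sin (ω / 2) : ℂ) * Real.sin (θ / 2) ^ 2 =
      Real.cos (ω / 2) * Real.cos (θ / 2) ^ 2 := by exact_mod_cast hrel
  have hc' : (Real.cos (θ / 2) : ℂ) ≠ 0 := by exact_mod_cast hc
  have hs' : (Real.sin (θ / 2) : ℂ) ≠ 0 := by exact_mod_cast hs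
  have hα (i : Fin n) : bondMode ω i.castSucc i.succ *ᵥ productState n (ketAlpha θ) = 0 := by
    refine bondMode_mulVec_productState ?_ i
    simp only [ketAlpha, Matrix.cons_val_zero, Matrix.cons_val_one, mul_pow, Complex.I_sq]
    linear_combination -hrel'
  have hβ (i : Fin n) : bondMode ω i.castSucc i.succ *ᵥ productState n (ketBeta θ) = 0 := by
    refine bondMode_mulVec_productState ?_ i
    simp only [ketBeta, Matrix.cons_val_zero, Matrix.cons_val_one, neg_sq, mul_pow, Complex.I_sq]
    linear_combination -hrel'
  rw [productSpan, Submodule.mem_span_pair]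
  constructor
  · rintro ⟨a, b, rfl⟩ i
    rw [Matrix.mulVec_add, Matrix.mulVec_smul, Matrix.mulVec_smul, hα, hβ, smul_zero, smul_zero,
      add_zero]
  · intro h
    set C := (Real.cos (θ / 2) : ℂ) with hC
    set S := (Real.sin (θ / 2) : ℂ) with hSd
    -- The product states agree on the empty configuration and differ by a sign on a single 1 at the
    -- first site. So the two amplitudes of ψ fix the sum `u` and the difference `w` of its
    -- coefficients.
    let u := ψ 0 / C ^ (n + 1)
    let w := ψ (Function.update 0 0 1) / (Complex.I * S * C ^ n)
    have hu : u * C ^ (n + 1) = ψ 0 := div_mul_cancel₀ _ (pow_ne_zero _ hc')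
    have hw : w * (Complex.I * S * C ^ n) = ψ (Function.update 0 0 1) :=
      div_mul_cancel₀ _ (mul_ne_zero (mul_ne_zero Complex.I_ne_zero hs') (pow_ne_zero _ hc'))
    refine ⟨(u + w) / 2, (u - w) / 2, ?_⟩
    rw [eq_comm, ← sub_eq_zero]
    refine eq_zero_of_bondMode_mulVec_eq_zero hS (fun i => ?_) ?_ ?_
    · rw [Matrix.mulVec_sub, Matrix.mulVec_add, Matrix.mulVec_smul, Matrix.mulVec_smul, hα, hβ, h,
        smul_zero, smul_zero, add_zero, sub_zero]
    · simp only [Pi.sub_apply, Pi.add_apply, Pi.smul_apply, productState_zero, ketAlpha, ketBeta,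
        Matrix.cons_val_zero, smul_eq_mul, ← hC]
      linear_combination -hu
    · simp only [Pi.sub_apply, Pi.add_apply, Pi.smul_apply, productState_update_zero, ketAlpha,
        ketBeta, Matrix.cons_val_zero, Matrix.cons_val_one, smul_eq_mul, ← hC, ← hSd]
      linear_combination -hw

lemma finrank_productSpan {θ : ℝ} (hc : Real.cos (θ / 2) ≠ 0) (hs : Real.sin (θ / 2) ≠ 0)
    (n : ℕ) : Module.finrank ℂ (productSpan θ n) = 2 := by
  have hc' : (Real.cos (θ / 2) : ℂ) ≠ 0 := by exact_mod_cast hc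
  have hs' : (Real.sin (θ / 2) : ℂ) ≠ 0 := by exact_mod_cast hs
  have hli : LinearIndependent ℂ
      ![productState n (ketAlpha θ), productState n (ketBeta θ)] := by
    rw [LinearIndependent.pair_iff]
    intro a b hab
    have h0 := congrFun hab 0
    have h1 := congrFun hab (Function.update 0 0 1)
    simp only [Pi.add_apply, Pi.smul_apply, productState_zero, productState_update_zero, ketAlpha,
      ketBeta, Matrix.cons_val_zero, Matrix.cons_val_one, smul_eq_mul, Pi.zero_apply] at h0 h1
    have e0 : (a + b) * (Real.cos (θ / 2) : ℂ) ^ (n + 1) = 0 := by linear_combination h0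
    have e1 : (a - b) * (Complex.I * Real.sin (θ / 2) * (Real.cos (θ / 2) : ℂ) ^ n) = 0 := by
      linear_combination h1
    have f0 := (mul_eq_zero.mp e0).resolve_right (pow_ne_zero _ hc')
    have f1 := (mul_eq_zero.mp e1).resolve_right
      (mul_ne_zero (mul_ne_zero Complex.I_ne_zero hs') (pow_ne_zero _ hc'))
    exact ⟨by linear_combination (f0 + f1) / 2, by linear_combination (f0 - f1) / 2⟩
  have := finrank_span_eq_card hli
  rwa [Matrix.range_cons, Matrix.range_cons, Matrix.range_empty, Set.union_empty,
    Set.singleton_union, Fintype.card_fin] at this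

/-! ### Detecting the interaction by traces -/

lemma trace_diag_mul_offDiag {D B : Matrix (Fin 2) (Fin 2) ℂ} (h01 : D 0 1 = 0) (h10 : D 1 0 = 0)
    (h00 : B 0 0 = 0) (h11 : B 1 1 = 0) : (D * B).trace = 0 := by
  simp [Matrix.trace_fin_two, Matrix.mul_apply, Fin.sum_univ_two, *]

lemma bondParity_eq_tensorOp {n : ℕ} (i j : Fin (n + 1)) :
    bondParity i j = (tensorOp fun k =>
      (if k = i then -pauliZ else 1) * (if k = j then -pauliZ else 1) : Op n) := by
  rw [bondParity_eq, siteOp, siteOp, tensorOp_mul]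
  congr 1
  funext k
  simp only [Function.update_apply]

/-- If i ≠ j, the factor on the rightmost of the two sites is diagonal times off-diagonal, hence
traceless. If i = j, the strings cancel, and whichever of p, q differs from i carries a bare -Z. -/
lemma trace_bondParity_mul_jordanWigner {n : ℕ} {p q : Fin (n + 1)} (hpq : p ≠ q)
    (i j : Fin (n + 1)) {B D : Matrix (Fin 2) (Fin 2) ℂ}
    (hB0 : B 0 0 = 0) (hB1 : B 1 1 = 0) (hD0 : D 0 0 = 0) (hD1 : D 1 1 = 0) :
    (bondParity p q * (jordanWigner i B * jordanWigner j D)).trace = 0 := by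
  have hdiag (k : Fin (n + 1)) :
      ((if k = p then -pauliZ else 1) * (if k = q then -pauliZ else 1)) 0 1 = 0 ∧
      ((if k = p then -pauliZ else 1) * (if k = q then -pauliZ else 1)) 1 0 = 0 := by
    split_ifs <;> simp [pauliZ]
  rw [bondParity_eq_tensorOp, jordanWigner, jordanWigner, tensorOp_mul, tensorOp_mul,
    trace_tensorOp]
  rcases lt_trichotomy i j with h | rfl | h
  · refine Finset.prod_eq_zero (Finset.mem_univ j) ?_
    refine trace_diag_mul_offDiag (hdiag j).1 (hdiag j).2 ?_ ?_ <;>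
      simp [h.not_gt, h.ne', hD0, hD1]
  · have hz (a b : Fin (n + 1)) (hab : a ≠ b) (hai : a ≠ i) :
        (((if a = a then -pauliZ else 1) * (if a = b then -pauliZ else 1)) *
          ((if a < i then pauliZ else if a = i then B else 1) *
            (if a < i then pauliZ else if a = i then D else 1))).trace = 0 := by
      split_ifs <;> simp_all [pauliZ_mul_pauliZ] <;> simp [pauliZ, Matrix.trace_fin_two]
    by_cases hp : p = i
    · refine Finset.prod_eq_zero (Finset.mem_univ q) ?_
      have := hz q p hpq.symm (hp ▸ hpq.symm)
      simpa [hpq.symm] using this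
    · exact Finset.prod_eq_zero (Finset.mem_univ p) (hz p q hpq hp)
  · refine Finset.prod_eq_zero (Finset.mem_univ i) ?_
    refine trace_diag_mul_offDiag (hdiag i).1 (hdiag i).2 ?_ ?_ <;>
      simp [h.not_gt, h.ne', hB0, hB1]

lemma majoranaA_eq {n : ℕ} (j : Fin (n + 1)) :
    majoranaA j = jordanWigner j (lowering + loweringᴴ) := by
  rw [majoranaA, c_conjTranspose, c_eq_jordanWigner, jordanWigner_add]

lemma majoranaB_eq {n : ℕ} (j : Fin (n + 1)) :
    majoranaB j = jordanWigner j ((-Complex.I) • (lowering + (-1 : ℂ) • loweringᴴ)) := by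
  rw [majoranaB, c_conjTranspose, c_eq_jordanWigner, jordanWigner_smul, jordanWigner_add,
    jordanWigner_smul, neg_one_smul, sub_eq_add_neg]

lemma exists_jordanWigner_of_majorana {n : ℕ} {γ : Op n}
    (h : γ ∈ Set.range (majoranaA (n := n)) ∪ Set.range (majoranaB (n := n))) :
    ∃ j B, γ = jordanWigner j B ∧ B 0 0 = 0 ∧ B 1 1 = 0 := by
  rcases h with ⟨j, rfl⟩ | ⟨j, rfl⟩
  · exact ⟨j, _, majoranaA_eq j, by simp [lowering], by simp [lowering]⟩
  · exact ⟨j, _, majoranaB_eq j, by simp [lowering], by simp [lowering]⟩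

lemma trace_bondParity_mul_of_mem_quadraticOps {n : ℕ} {p q : Fin (n + 1)} (hpq : p ≠ q)
    {T : Op n} (hT : T ∈ quadraticOps n) : (bondParity p q * T).trace = 0 := by
  induction hT using Submodule.span_induction with
  | mem T hT =>
    obtain ⟨γ, hγ, γ', hγ', rfl⟩ := hT
    obtain ⟨i, B, rfl, hB0, hB1⟩ := exists_jordanWigner_of_majorana hγ
    obtain ⟨j, D, rfl, hD0, hD1⟩ := exists_jordanWigner_of_majorana hγ'
    exact trace_bondParity_mul_jordanWigner hpq i j hB0 hB1 hD0 hD1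
  | zero => simp
  | add S T _ _ hS hT => rw [mul_add, Matrix.trace_add, hS, hT, add_zero]
  | smul a T _ hT => rw [mul_smul_comm, Matrix.trace_smul, hT, smul_zero]

lemma trace_bondParity_mul_bondParity {n : ℕ} {p q i j : Fin (n + 1)} (hpq : p ≠ q)
    (hi : p ≠ i) (hj : p ≠ j) : (bondParity p q * bondParity i j : Op n).trace = 0 := by
  rw [bondParity_eq_tensorOp, bondParity_eq_tensorOp, tensorOp_mul, trace_tensorOp]
  refine Finset.prod_eq_zero (Finset.mem_univ p) ?_
  simp [hpq, hi, hj, pauliZ, Matrix.trace_fin_two]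

/-- The first bond is the only one that touches site 0; any other bond leaves a traceless -Z there,
so only the trace of the identity survives. -/
lemma trace_bondParity_mul_sum (n : ℕ) :
    (bondParity (0 : Fin (n + 1)).castSucc (0 : Fin (n + 1)).succ *
      ∑ i : Fin (n + 1), bondParity i.castSucc i.succ).trace ≠ 0 := by
  have hne : (0 : Fin (n + 1)).castSucc ≠ (0 : Fin (n + 1)).succ :=
    (Fin.castSucc_lt_succ (i := (0 : Fin (n + 1)))).ne
  rw [Finset.mul_sum, Matrix.trace_sum, Finset.sum_eq_single 0]
  · rw [bondParity_mul_self hne, Matrix.trace_one]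
    exact_mod_cast Fintype.card_ne_zero
  · intro i _ hi
    refine trace_bondParity_mul_bondParity hne ?_ ?_
    · exact fun h => hi (Fin.castSucc_injective _ h).symm
    · rw [Fin.castSucc_zero]
      exact (Fin.succ_ne_zero i).symm
  · simp

lemma c_mem_span_majorana {n : ℕ} (j : Fin (n + 1)) :
    c j ∈ Submodule.span ℂ
      (Set.range (majoranaA (n := n)) ∪ Set.range (majoranaB (n := n))) := by
  have h : c j = (1 / 2 : ℂ) • majoranaA j + (Complex.I / 2) • majoranaB j := by
    rw [majoranaA, majoranaB, smul_smul,
      show Complex.I / 2 * -Complex.I = 1 / 2 by linear_combination (-1 / 2) * Complex.I_mul_I]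
    module
  rw [h]
  exact Submodule.add_mem _
    (Submodule.smul_mem _ _ (Submodule.subset_span (Or.inl ⟨j, rfl⟩)))
    (Submodule.smul_mem _ _ (Submodule.subset_span (Or.inr ⟨j, rfl⟩)))

lemma c_conjTranspose_mem_span_majorana {n : ℕ} (j : Fin (n + 1)) :
    (c j)ᴴ ∈ Submodule.span ℂ
      (Set.range (majoranaA (n := n)) ∪ Set.range (majoranaB (n := n))) := by
  have h : (c j)ᴴ = majoranaA j - c j := by rw [majoranaA, add_sub_cancel_left]
  rw [h]
  exact Submodule.sub_mem _ (Submodule.subset_span (Or.inl ⟨j, rfl⟩)) (c_mem_span_majorana j)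

lemma mul_mem_quadraticOps {n : ℕ} {S T : Op n}
    (hS : S ∈ Submodule.span ℂ
      (Set.range (majoranaA (n := n)) ∪ Set.range (majoranaB (n := n))))
    (hT : T ∈ Submodule.span ℂ
      (Set.range (majoranaA (n := n)) ∪ Set.range (majoranaB (n := n)))) :
    S * T ∈ quadraticOps n := by
  have := Submodule.mul_mem_mul hS hT
  rw [Submodule.span_mul_span] at this
  refine Submodule.span_mono ?_ this
  rintro _ ⟨γ, hγ, γ', hγ', rfl⟩
  exact ⟨γ, hγ, γ', hγ', rfl⟩

lemma one_mem_quadraticOps (n : ℕ) : (1 : Op n) ∈ quadraticOps n := by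
  have h := c_mul_conjTranspose_anticomm (n := n) 0 0
  rw [if_pos rfl] at h
  rw [← h]
  exact Submodule.add_mem _
    (mul_mem_quadraticOps (c_mem_span_majorana 0) (c_conjTranspose_mem_span_majorana 0))
    (mul_mem_quadraticOps (c_conjTranspose_mem_span_majorana 0) (c_mem_span_majorana 0))

/-- The quadratic part of the dimer term. -/
def quadraticDimer {n : ℕ} (A ω s : ℝ) (i j : Fin (n + 1)) : Op n :=
  (-2 * A) • (((c i)ᴴ * c j + (c j)ᴴ * c i)
    + ((1 + 2 * s) * Real.sin ω) • (c i * c j + (c j)ᴴ * (c i)ᴴ)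
    + ((1 + 2 * s) * Real.cos ω) • (num i + num j - 1))

lemma quadraticDimer_mem {n : ℕ} (A ω s : ℝ) (i j : Fin (n + 1)) :
    quadraticDimer A ω s i j ∈ quadraticOps n := by
  have h1 := c_mem_span_majorana (n := n)
  have h2 := c_conjTranspose_mem_span_majorana (n := n)
  have hop : (c i)ᴴ * c j + (c j)ᴴ * c i ∈ quadraticOps n :=
    Submodule.add_mem _ (mul_mem_quadraticOps (h2 i) (h1 j)) (mul_mem_quadraticOps (h2 j) (h1 i))
  have pair : c i * c j + (c j)ᴴ * (c i)ᴴ ∈ quadraticOps n :=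
    Submodule.add_mem _ (mul_mem_quadraticOps (h1 i) (h1 j)) (mul_mem_quadraticOps (h2 j) (h2 i))
  have site : num i + num j - 1 ∈ quadraticOps n :=
    Submodule.sub_mem _ (Submodule.add_mem _ (mul_mem_quadraticOps (h2 i) (h1 i))
      (mul_mem_quadraticOps (h2 j) (h1 j))) (one_mem_quadraticOps n)
  have hr (r : ℝ) {T : Op n} (hT : T ∈ quadraticOps n) : r • T ∈ quadraticOps n := by
    rw [← Complex.coe_smul]
    exact Submodule.smul_mem _ _ hT
  rw [quadraticDimer]
  exact hr _ (Submodule.add_mem _ (Submodule.add_mem _ hop (hr _ pair)) (hr _ site))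

lemma Hs_eq_quadratic_add (A ω s : ℝ) (n : ℕ) :
    Hs A ω s n = ∑ i : Fin n, quadraticDimer A ω s i.castSucc i.succ +
      ((2 * A * s : ℝ) : ℂ) • ∑ i : Fin n, bondParity i.castSucc i.succ := by
  rw [Hs, Finset.smul_sum, ← Finset.sum_add_distrib]
  refine Finset.sum_congr rfl fun i _ => ?_
  rw [Complex.coe_smul, dimer, ← bondParity, quadraticDimer]
  module

lemma nonInteracting_Hs_iff {A : ℝ} (hA : 0 < A) (ω s : ℝ) (n : ℕ) :
    NonInteracting (Hs A ω s (n + 1)) ↔ s = 0 := by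
  have hq : ∑ i : Fin (n + 1), quadraticDimer A ω s i.castSucc i.succ ∈ quadraticOps (n + 1) :=
    Submodule.sum_mem _ fun i _ => quadraticDimer_mem A ω s _ _
  rw [NonInteracting, Hs_eq_quadratic_add, Submodule.add_mem_iff_right _ hq]
  constructor
  · intro h
    by_contra hs
    have hne : ((2 * A * s : ℝ) : ℂ) ≠ 0 := by
      exact_mod_cast mul_ne_zero (mul_ne_zero two_ne_zero hA.ne') hs
    rw [Submodule.smul_mem_iff _ hne] at h
    exact trace_bondParity_mul_sum n (trace_bondParity_mul_of_mem_quadraticOps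
      (Fin.castSucc_lt_succ (i := (0 : Fin (n + 1)))).ne h)
  · rintro rfl
    simp

/-! ### Identification with the fermion chain -/

/-- An inner site belongs to two bonds and an end site to one, which is exactly the ratio of the
potentials. -/
lemma sum_halvedAtEnds_smul {n : ℕ} (μ : ℝ) {M : Type*} [AddCommGroup M] [Module ℝ M]
    (f : Fin (n + 1 + 1) → M) :
    ∑ j, halvedAtEnds (n + 1) μ j • f j =
      (μ / 2) • ∑ i : Fin (n + 1), (f i.castSucc + f i.succ) := by
  have h (j : Fin (n + 1 + 1)) : halvedAtEnds (n + 1) μ j • f j = μ • f j -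
      (if j = 0 then (μ / 2) • f j else 0) - (if j = Fin.last (n + 1) then (μ / 2) • f j else 0) := by
    unfold halvedAtEnds
    by_cases h0 : j = 0
    · have : j ≠ Fin.last (n + 1) := by rw [h0]; exact (Fin.last_pos).ne
      rw [if_neg this, if_pos (Or.inl h0), if_pos h0]
      module
    · by_cases h1 : j = Fin.last (n + 1)
      · rw [if_pos (Or.inr h1), if_neg h0, if_pos h1]
        module
      · rw [if_neg (not_or.mpr ⟨h0, h1⟩), if_neg h0, if_neg h1, sub_zero, sub_zero]
  simp only [h, Finset.sum_sub_distrib, Finset.sum_ite_eq', Finset.mem_univ, if_true,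
    ← Finset.smul_sum, Finset.sum_add_distrib]
  have h1 := Fin.sum_univ_succ f
  have h2 := Fin.sum_univ_castSucc f
  linear_combination (norm := module) (μ / 2) • h1 + (μ / 2) • h2

lemma Hs_eq_fermionChain {A : ℝ} (hA : 0 < A) (ω B : ℝ) (n : ℕ) :
    Hs A ω ((B - A) / (2 * A)) (n + 1) =
      fermionChain (n + 1) (2 * A) (-2 * B * Real.sin ω)
        (halvedAtEnds (n + 1) (4 * B * Real.cos ω)) (B - A) := by
  have h1 : 1 + 2 * ((B - A) / (2 * A)) = B / A := by field_simp; ring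
  rw [fermionChain, sum_halvedAtEnds_smul, Hs, Finset.smul_sum, Finset.smul_sum, Finset.smul_sum,
    ← Finset.sum_sub_distrib, ← Finset.sum_add_distrib]
  refine Finset.sum_congr rfl fun i _ => ?_
  have e1 : -2 * A * (B / A * Real.sin ω) = -2 * B * Real.sin ω := by field_simp
  have e2 : -2 * A * (B / A * Real.cos ω) = -2 * B * Real.cos ω := by field_simp
  have e3 : -2 * A * ((B - A) / (2 * A)) = -(B - A) := by field_simp
  rw [dimer, h1, smul_sub, smul_add, smul_add, smul_smul, smul_smul, smul_smul, e1, e2, e3]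
  module

/-! ### Energies, ground space and gap of the Hamiltonian -/

lemma mem_energies_iff {n : ℕ} {H : Op n} {E : ℝ} :
    E ∈ energies H ↔ ∃ v : State n, v ≠ 0 ∧ H *ᵥ v = (E : ℂ) • v := by
  rw [energies, Set.mem_ofPred_eq]
  constructor
  · intro h
    obtain ⟨v, hv⟩ := h.exists_hasEigenvector
    exact ⟨v, hv.2, by simpa using hv.apply_eq_smul⟩
  · rintro ⟨v, hv, h⟩
    exact Module.End.hasEigenvalue_of_hasEigenvector
      (Module.End.hasEigenvector_iff.mpr
        ⟨Module.End.mem_eigenspace_iff.mpr (by simpa using h), hv⟩)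

lemma Hs_mulVec_eq_smul_iff {A ω s : ℝ} (hA : 0 < A) {n : ℕ} {E : ℝ} {v : State n} :
    Hs A ω s n *ᵥ v = (E : ℂ) • v ↔
      parentOp ω s n *ᵥ v = (((E + 2 * A * (1 + s) * n) / (4 * A) : ℝ) : ℂ) • v := by
  have hA' : ((4 * A : ℝ) : ℂ) ≠ 0 := by exact_mod_cast (by positivity : (4 * A : ℝ) ≠ 0)
  have hdiv : ((4 * A : ℝ) : ℂ) * (((E + 2 * A * (1 + s) * n) / (4 * A) : ℝ) : ℂ) =
      (E : ℂ) - ((-2 * A * (1 + s) * n : ℝ) : ℂ) := by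
    rw [← Complex.ofReal_mul, mul_div_cancel₀ _ (by positivity : (4 * A : ℝ) ≠ 0)]
    push_cast; ring
  rw [Hs_eq, Matrix.add_mulVec, Matrix.smul_mulVec, Matrix.smul_mulVec, Matrix.one_mulVec,
    ← (smul_right_injective (State n) hA').eq_iff (a := parentOp ω s n *ᵥ v),
    smul_smul, hdiv, sub_smul, eq_sub_iff_add_eq,
    add_comm]

/-- The nonzero kernel vector `φ` is needed for the bound -2A(1+s)n to be attained. -/
lemma isLeast_energies_Hs {A ω s : ℝ} (hA : 0 < A) (hs : -1 / 2 < s) {n : ℕ} {φ : State n}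
    (hφ : φ ≠ 0) (h : ∀ i : Fin n, bondMode ω i.castSucc i.succ *ᵥ φ = 0) :
    IsLeast (energies (Hs A ω s n)) (-(2 * A * (1 + s) * n)) := by
  constructor
  · refine mem_energies_iff.mpr ⟨φ, hφ, (Hs_mulVec_eq_smul_iff hA).mpr ?_⟩
    rw [parentOp_mulVec_eq_zero_of_bondMode h]
    simp
  · intro E hE
    obtain ⟨v, hv, hE⟩ := mem_energies_iff.mp hE
    have := parentOp_eigenvalue_nonneg hs hv ((Hs_mulVec_eq_smul_iff hA).mp hE)
    rw [le_div_iff₀ (by positivity)] at this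
    linarith

lemma groundEnergy_Hs {A ω s : ℝ} (hA : 0 < A) (hs : -1 / 2 < s) {n : ℕ} {φ : State n}
    (hφ : φ ≠ 0) (h : ∀ i : Fin n, bondMode ω i.castSucc i.succ *ᵥ φ = 0) :
    groundEnergy (Hs A ω s n) = -(2 * A * (1 + s) * n) :=
  (isLeast_energies_Hs hA hs hφ h).csInf_eq

lemma mem_groundSpace_Hs_iff {A ω s : ℝ} (hA : 0 < A) (hs : -1 / 2 < s) {n : ℕ} {φ : State n}
    (hφ : φ ≠ 0) (h : ∀ i : Fin n, bondMode ω i.castSucc i.succ *ᵥ φ = 0) {ψ : State n} :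
    ψ ∈ groundSpace (Hs A ω s n) ↔ ∀ i : Fin n, bondMode ω i.castSucc i.succ *ᵥ ψ = 0 := by
  rw [groundSpace, Module.End.mem_eigenspace_iff, Matrix.toLin'_apply, Hs_mulVec_eq_smul_iff hA,
    groundEnergy_Hs hA hs hφ h, neg_add_cancel, zero_div, Complex.ofReal_zero, zero_smul,
    parentOp_mulVec_eq_zero_iff hs]

lemma gapAtLeast_Hs {A ω s : ℝ} (hA : 0 < A) (hs : -1 / 2 < s) (hω : |Real.cos ω| < 1) {n : ℕ}
    {φ : State n} (hφ : φ ≠ 0) (h : ∀ i : Fin n, bondMode ω i.castSucc i.succ *ᵥ φ = 0) {δ : ℝ}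
    (hδ : δ ≤ 4 * A * (min 1 (1 + 2 * s) * (1 - |Real.cos ω|))) :
    GapAtLeast (Hs A ω s n) δ := by
  intro E hE hne
  rw [groundEnergy_Hs hA hs hφ h] at hne ⊢
  obtain ⟨v, hv, hE⟩ := mem_energies_iff.mp hE
  have hr : (E + 2 * A * (1 + s) * n) / (4 * A) ≠ 0 :=
    div_ne_zero (fun h0 => hne (by linarith)) (by positivity)
  have := parentOp_eigenvalue_ge hs hω hv hr ((Hs_mulVec_eq_smul_iff hA).mp hE)
  rw [le_div_iff₀ (by positivity)] at this
  linarith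

lemma continuous_Hs (A ω : ℝ) (n : ℕ) : Continuous fun s : ℝ => Hs A ω s n := by
  simp only [Hs, dimer]
  fun_prop

/-! ### Trigonometry of the angles -/

/-- With q the square root, the hypothesis reads q cos(ω/2) = sin²(θ/2), and therefore q sin(ω/2) =
cos²(θ/2). The conclusion is the condition for d to annihilate the product states, whose second
component squares to -sin²(θ/2). -/
lemma sin_half_mul_sq {θ ω : ℝ} (hω : ω ∈ Set.Ioo 0 Real.pi)
    (hrel : Real.cos (ω / 2) =
      Real.sin (θ / 2) ^ 2 / Real.sqrt (Real.sin (θ / 2) ^ 4 + Real.cos (θ / 2) ^ 4)) :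
    Real.sin (ω / 2) * Real.sin (θ / 2) ^ 2 = Real.cos (ω / 2) * Real.cos (θ / 2) ^ 2 := by
  have hS : 0 < Real.sin (ω / 2) :=
    Real.sin_pos_of_pos_of_lt_pi (by linarith [hω.1]) (by linarith [hω.2, Real.pi_pos])
  set S := Real.sin (θ / 2)
  set C := Real.cos (θ / 2)
  have hSC : S ^ 2 + C ^ 2 = 1 := Real.sin_sq_add_cos_sq _
  have hpos : 0 < S ^ 4 + C ^ 4 := by nlinarith [sq_nonneg (S ^ 2 - C ^ 2)]
  have hq := Real.sqrt_pos.mpr hpos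
  have hqq := Real.sq_sqrt hpos.le
  set q := Real.sqrt (S ^ 4 + C ^ 4)
  have hcos : Real.cos (ω / 2) * q = S ^ 2 := by rw [hrel, div_mul_cancel₀ _ hq.ne']
  have hsin : Real.sin (ω / 2) * q = C ^ 2 := by
    have h2 : (Real.sin (ω / 2) * q) ^ 2 = (C ^ 2) ^ 2 := by
      linear_combination q ^ 2 * Real.sin_sq_add_cos_sq (ω / 2) -
        (Real.cos (ω / 2) * q + S ^ 2) * hcos + hqq
    exact (pow_left_inj₀ (by positivity) (by positivity) two_ne_zero).mp h2
  rw [← hcos, ← hsin]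
  ring

lemma abs_cos_lt_one {ω : ℝ} (hω : ω ∈ Set.Ioo 0 Real.pi) : |Real.cos ω| < 1 := by
  have := Real.sin_pos_of_mem_Ioo hω
  rw [← sq_lt_one_iff_abs_lt_one]
  nlinarith [Real.sin_sq_add_cos_sq ω]

end KitaevFF

end

theorem mainTheorem3 (A θ ω : ℝ) (hA : 0 < A)
    (hθ : θ ∈ Set.Ioo 0 Real.pi) (hω : ω ∈ Set.Ioo 0 Real.pi)
    (hrel : Real.cos (ω / 2) =
      Real.sin (θ / 2) ^ 2 / Real.sqrt (Real.sin (θ / 2) ^ 4 + Real.cos (θ / 2) ^ 4)) :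
    -- for `s = (B - A) / 2A` this is the interacting fermion chain with parameters given by `A, B`
    (∀ B : ℝ, 0 < B → ∀ n ≥ 1, KitaevFF.Hs A ω ((B - A) / (2 * A)) n =
      KitaevFF.fermionChain n (2 * A) (-2 * B * Real.sin ω)
        (KitaevFF.halvedAtEnds n (4 * B * Real.cos ω)) (B - A)) ∧
    -- common two-dimensional ground space for all `s > -1/2`
    (∀ s : ℝ, -1 / 2 < s → ∀ n ≥ 1, (KitaevFF.Hs A ω s n).IsHermitian ∧
      KitaevFF.groundSpace (KitaevFF.Hs A ω s n) = KitaevFF.productSpan θ n ∧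
      Module.finrank ℂ (KitaevFF.productSpan θ n) = 2) ∧
    -- every member of the family is gapped uniformly in the length of the chain
    (∀ s : ℝ, -1 / 2 < s → ∃ δ : ℝ, 0 < δ ∧ ∀ n ≥ 1, KitaevFF.GapAtLeast (KitaevFF.Hs A ω s n) δ) ∧
    -- `s = 0` is the Kitaev chain in the topologically ordered regime
    (∀ n ≥ 1, KitaevFF.Hs A ω 0 n =
      KitaevFF.kitaevChain n (2 * A) (-2 * A * Real.sin ω) (4 * A * Real.cos ω)) ∧
    KitaevFF.TopologicalRegime (2 * A) (-2 * A * Real.sin ω) (4 * A * Real.cos ω) ∧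
    -- the non-interacting member is exactly `s = 0`
    (∀ s : ℝ, -1 / 2 < s → ∀ n ≥ 1, KitaevFF.NonInteracting (KitaevFF.Hs A ω s n) ↔ s = 0) ∧
    -- `s' ↦ H'(s')` is a continuous path that joins `H'(s)` to `H'(0)` without closing the gap
    (∀ n ≥ 1, Continuous fun s : ℝ => KitaevFF.Hs A ω s n) ∧
    (∀ s : ℝ, -1 / 2 < s → ∃ δ : ℝ, 0 < δ ∧ ∀ s' ∈ Set.uIcc 0 s, ∀ n ≥ 1,
      KitaevFF.GapAtLeast (KitaevFF.Hs A ω s' n) δ) := by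
  have hc : Real.cos (θ / 2) ≠ 0 := (Real.cos_pos_of_mem_Ioo
    ⟨by linarith [hθ.1, Real.pi_pos], by linarith [hθ.2]⟩).ne'
  have hs : Real.sin (θ / 2) ≠ 0 := (Real.sin_pos_of_pos_of_lt_pi
    (by linarith [hθ.1]) (by linarith [hθ.2, Real.pi_pos])).ne'
  have hS : Real.sin (ω / 2) ≠ 0 := (Real.sin_pos_of_pos_of_lt_pi
    (by linarith [hω.1]) (by linarith [hω.2, Real.pi_pos])).ne'
  have hsinω : Real.sin ω ≠ 0 := (Real.sin_pos_of_mem_Ioo hω).ne'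
  have hcosω := KitaevFF.abs_cos_lt_one hω
  have hmem {n : ℕ} {ψ : KitaevFF.State n} :=
    KitaevFF.mem_productSpan_iff (ψ := ψ) hc hs hS (KitaevFF.sin_half_mul_sq hω hrel)
  have hker (n : ℕ) := hmem.mp (Submodule.subset_span (Set.mem_insert _ _) :
    KitaevFF.productState n (KitaevFF.ketAlpha θ) ∈ KitaevFF.productSpan θ n)
  have hne (n : ℕ) : KitaevFF.productState n (KitaevFF.ketAlpha θ) ≠ 0 := by
    intro h
    have h0 := KitaevFF.productState_zero n (KitaevFF.ketAlpha θ)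
    rw [h, Pi.zero_apply, eq_comm, pow_eq_zero_iff n.succ_ne_zero] at h0
    exact hc (Complex.ofReal_eq_zero.mp h0)
  have hδ {s : ℝ} (hs : -1 / 2 < s) : 0 < 4 * A * (min 1 (1 + 2 * s) * (1 - |Real.cos ω|)) :=
    mul_pos (by positivity) (mul_pos (lt_min one_pos (by linarith)) (sub_pos.mpr hcosω))
  have hchain : ∀ B : ℝ, 0 < B → ∀ n ≥ 1, KitaevFF.Hs A ω ((B - A) / (2 * A)) n =
      KitaevFF.fermionChain n (2 * A) (-2 * B * Real.sin ω)
        (KitaevFF.halvedAtEnds n (4 * B * Real.cos ω)) (B - A) := by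
    intro B _ n hn
    obtain ⟨m, rfl⟩ := Nat.exists_eq_succ_of_ne_zero (Nat.one_le_iff_ne_zero.mp hn)
    exact KitaevFF.Hs_eq_fermionChain hA ω B m
  refine ⟨hchain, fun s hs' n _ => ⟨KitaevFF.Hs_isHermitian A ω s n, ?_,
    KitaevFF.finrank_productSpan hc hs n⟩, fun s hs' => ⟨_, hδ hs', fun n _ =>
      KitaevFF.gapAtLeast_Hs hA hs' hcosω (hne n) (hker n) le_rfl⟩, fun n hn => ?_, ⟨?_, ?_⟩,
    fun s _ n hn => ?_, fun n _ => KitaevFF.continuous_Hs A ω n,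
    fun s hs' => ⟨_, hδ hs', fun s' hs'' n _ => ?_⟩⟩
  · ext ψ
    rw [KitaevFF.mem_groundSpace_Hs_iff hA hs' (hne n) (hker n), hmem]
  -- The Kitaev chain is the case B = A.
  · simpa [KitaevFF.kitaevChain] using hchain A hA n hn
  · rw [abs_mul, abs_of_pos (by positivity : 0 < 4 * A), abs_of_pos (by positivity : 0 < 2 * A)]
    nlinarith
  · exact mul_ne_zero (by nlinarith) hsinω
  · obtain ⟨m, rfl⟩ := Nat.exists_eq_succ_of_ne_zero (Nat.one_le_iff_ne_zero.mp hn)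
    exact KitaevFF.nonInteracting_Hs_iff hA ω s m
  · have hle : min 0 s ≤ s' := (Set.mem_uIcc.mp hs'').elim
      (fun h => (min_le_left _ _).trans h.1) (fun h => (min_le_right _ _).trans h.1)
    -- The bound min(1, 1+2s) is nondecreasing in s and equals 1 for s ≥ 0, so between 0 and s it is
    -- smallest at s. The δ found for s thus serves the whole path.
    have hmin : min 1 (1 + 2 * s) ≤ min 1 (1 + 2 * s') := by
      refine le_min (min_le_left _ _) ?_
      rcases le_total 0 s with h | h
      · rw [min_eq_left h] at hle
        exact (min_le_left _ _).trans (by linarith)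
      · rw [min_eq_right h] at hle
        exact (min_le_right _ _).trans (by linarith)
    refine KitaevFF.gapAtLeast_Hs hA ?_ hcosω (hne n) (hker n)
      (mul_le_mul_of_nonneg_left (mul_le_mul_of_nonneg_right hmin (sub_pos.mpr hcosω).le)
        (by positivity))
    exact lt_of_lt_of_le (lt_min (by norm_num) hs') hle
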